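/- Let $N\ge 2$, $s\in(0,1)$, $\gamma\in(0,1)$, and let $B$ be the open unit ball of $\mathbb{R}^N$. Let $u:\mathbb{R}^N\to\mathbb{R}$ satisfy the following. (i) $u\in C^{\gamma+2s}_{\rm loc}(B)$: writing $\gamma+2s=k+\alpha$ with $k\in\mathbb{N}_0$ and $\alpha\in(0,1]$, $u$ is of class $C^k$ in $B$ and its derivatives of order $k$ are $\alpha$-Hölder continuous on every compact subset of $B$. (ii) $u\in L^1_s(\mathbb{R}^N)$: $u$ is Lebesgue measurable and $\int_{\mathbb{R}^N}\frac{|u(x)|}{1+|x|^{N+2s}}\,dx<\infty$. (iii) $u$ is very weakly $s$-harmonic in $B$: $\int_{\mathbb{R}^N}u\,(-\Delta)^s\varphi\,dx=0$ for every integrable $\varphi:\mathbb{R}^N\to\mathbb{R}$ with compact support contained in $B$ such that $(-\Delta)^s\varphi\in L^\infty_s(\mathbb{R}^N)$. Here $L^\infty_s(\mathbb{R}^N)$ is the space of measurable $f$ with $\operatorname{ess\,sup}_{x}(1+|x|^{N+2s})|f(x)|<\infty$, and $(-\Delta)^s\varphi=f$ is understood in the sense of distributions, i.e. $\int\varphi\,(-\Delta)^s\psi\,dx=\int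 f\psi\,dx$ for all $\psi\in C^\infty_c(\mathbb{R}^N)$, where $$(-\Delta)^s\psi(x)=\frac{C_{N,s}}{2}\int_{\mathbb{R}^N}\frac{2\psi(x)-\psi(x+y)-\psi(x-y)}{|y|^{N+2s}}\,dy,\qquad C_{N,s}=\frac{s\,2^{2s}\,\Gamma\left(\frac N2+s\right)}{\pi^{N/2}\,\Gamma(1-s)}.$$ Then $u$ is real analytic in $B$. -/

import Mathlib

open MeasureTheory
open scoped ContDiff

/-- The normalisation constant
`C_{N,s} = s 2^{2s} Γ(N/2 + s) / (π^{N/2} Γ(1 - s))` of the fractional Laplacian. -/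
noncomputable def fracLaplacianConst (N : ℕ) (s : ℝ) : ℝ :=
  s * (2 : ℝ) ^ (2 * s) * Real.Gamma ((N : ℝ) / 2 + s) /
    (Real.pi ^ ((N : ℝ) / 2) * Real.Gamma (1 - s))

/-- The fractional Laplacian in symmetric form,
`(-Δ)^s w (x) = (C_{N,s} / 2) ∫ (2 w(x) - w(x+y) - w(x-y)) / |y|^{N+2s} dy`.
The integral converges absolutely at every point when `w` is smooth with compact support,
and below it is only applied to such functions. -/
noncomputable def fracLaplacian {N : ℕ} (s : ℝ) (w : EuclideanSpace ℝ (Fin N) → ℝ)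
    (x : EuclideanSpace ℝ (Fin N)) : ℝ :=
  fracLaplacianConst N s / 2 *
    ∫ y : EuclideanSpace ℝ (Fin N),
      (2 * w x - w (x + y) - w (x - y)) / ‖y‖ ^ ((N : ℝ) + 2 * s)

/-- `u ∈ L¹_s(ℝ^N)`: `u` is Lebesgue measurable and `∫ |u(x)| / (1 + |x|^{N+2s}) dx < ∞`. -/
def MemL1s {N : ℕ} (s : ℝ) (u : EuclideanSpace ℝ (Fin N) → ℝ) : Prop :=
  Integrable (fun x => u x / (1 + ‖x‖ ^ ((N : ℝ) + 2 * s))) volume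

/-- `f ∈ L^∞_s(ℝ^N)`: `f` is Lebesgue measurable and `(1 + |x|^{N+2s}) |f(x)|` is essentially
bounded. -/
def MemLInftys {N : ℕ} (s : ℝ) (f : EuclideanSpace ℝ (Fin N) → ℝ) : Prop :=
  AEStronglyMeasurable f volume ∧
    ∃ C : ℝ, ∀ᵐ x ∂(volume : Measure (EuclideanSpace ℝ (Fin N))),
      (1 + ‖x‖ ^ ((N : ℝ) + 2 * s)) * |f x| ≤ C

/-- `(-Δ)^s φ = f` on `ℝ^N` in the sense of distributions. -/
def HasFracLaplacian {N : ℕ} (s : ℝ) (φ f : EuclideanSpace ℝ (Fin N) → ℝ) : Prop :=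
  ∀ ψ : EuclideanSpace ℝ (Fin N) → ℝ, ContDiff ℝ ∞ ψ → HasCompactSupport ψ →
    ∫ x, φ x * fracLaplacian s ψ x = ∫ x, f x * ψ x

/-- `u` is very weakly `s`-harmonic in the open set `U`: `∫ u (-Δ)^s φ dx = 0` for every
(integrable) `φ` compactly supported in `U` such that `(-Δ)^s φ ∈ L^∞_s(ℝ^N)`. Here `f` stands
for the function `(-Δ)^s φ`, which is determined up to a null set. -/
def IsVeryWeakSHarmonicOn {N : ℕ} (s : ℝ) (u : EuclideanSpace ℝ (Fin N) → ℝ)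
    (U : Set (EuclideanSpace ℝ (Fin N))) : Prop :=
  ∀ φ f : EuclideanSpace ℝ (Fin N) → ℝ,
    Integrable φ volume → HasCompactSupport φ → tsupport φ ⊆ U →
    HasFracLaplacian s φ f → MemLInftys s f →
    ∫ x, u x * f x = 0

/-- `u ∈ C^β_loc(U)` for `U` open and `β > 0`: writing `β = k + α` with `k ∈ ℕ` and
`α ∈ (0, 1]`, the function `u` is of class `C^k` in `U` and its `k`-th derivative is
`α`-Hölder continuous on every compact subset of `U`. -/
def HolderLocOn {N : ℕ} (β : ℝ) (u : EuclideanSpace ℝ (Fin N) → ℝ)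
    (U : Set (EuclideanSpace ℝ (Fin N))) : Prop :=
  ∃ (k : ℕ) (α : ℝ), 0 < α ∧ α ≤ 1 ∧ (k : ℝ) + α = β ∧
    ContDiffOn ℝ k u U ∧
    ∀ K : Set (EuclideanSpace ℝ (Fin N)), IsCompact K → K ⊆ U →
      ∃ C : ℝ, ∀ x ∈ K, ∀ y ∈ K,
        ‖iteratedFDeriv ℝ k u x - iteratedFDeriv ℝ k u y‖ ≤ C * ‖x - y‖ ^ α

/-! The proof represents `u` by a Poisson integral obtained by duality and reads analyticity off the
kernel.

For a ball of squared radius `λ`, the kernel `(‖z‖² - λ)₊^{-s} ‖x - z‖^{-N}` has, at points `y`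
outside the ball, the same Riesz potential of order `2s` as a multiple of the point mass at `x`; the
multiple is a constant times `(λ - ‖x‖²)^{-s}` (`lintegral_cutPow_mul_riesz`). This kernel is
singular at the sphere, so it cannot be used against the class `L^∞_s`. Integrating it over `λ ∈ [a,
b]` with `b < 1` makes the weight bounded and keeps the decay `‖z‖^{-N-2s}`.

Sweep a density `χ` on a small ball with the averaged kernel. The difference between a weighted copy
of `χ` and its sweep has zero Riesz potential for `‖y‖² > b` (`rieszPotential_sweep`). Since the
Riesz potential inverts the fractional Laplacian up to a constant
(`exists_integral_riesz_mul_fracLap`), this difference is `(-Δ)^s φ` for some `φ` compactly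
supported in the unit ball. Hence `u` is orthogonal to it
(`IsFracLapHarmonic.integral_mul_eq_zero`). By Fubini, `χ` is then orthogonal to the defect between
a weighted `u` and its averaged Poisson integral. Choosing `χ` to be the defect itself makes its
square integrate to zero, and continuity of `u` gives the formula at every point
(`IsFracLapHarmonic.avgPoissonIntegral_eq`).

The Poisson integral is analytic because `‖x - z‖^{-N}` is analytic in `x`, uniformly over the `z`
carrying the weight (`analyticAt_integral_norm_sub_rpow`), and the normalising factor is analytic
and positive. -/

open Set

/-! ### Truncated powers of a quadratic on a half-line -/

/-- The truncated power `a ↦ a₊^{-s}`, with value `0` for `a ≤ 0`. -/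
noncomputable def cutPow (s a : ℝ) : ℝ := if 0 < a then a ^ (-s) else 0

lemma cutPow_of_pos {s a : ℝ} (ha : 0 < a) : cutPow s a = a ^ (-s) := if_pos ha

lemma cutPow_of_nonpos {s a : ℝ} (ha : a ≤ 0) : cutPow s a = 0 := if_neg ha.not_gt

lemma cutPow_nonneg (s a : ℝ) : 0 ≤ cutPow s a := by
  unfold cutPow
  split_ifs with h
  · positivity
  · exact le_rfl

@[fun_prop]
lemma measurable_cutPow (s : ℝ) : Measurable (cutPow s) :=
  Measurable.ite measurableSet_Ioi (by fun_prop) measurable_const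

/-- Substitute `ρ = (q + β t - δ t²) / (δ t²)`. In terms of `1/t` this is a quadratic equation, with
positive solution `1/t = √(m² + (δ/q)(1 + ρ)) - m` for `m = β / (2q)`. The exponent `2s - 1` is the
one for which only a factor `1/t` survives besides `(δρ)^{-s}` and the Jacobian. -/
lemma lintegral_rpow_mul_cutPow_quadratic {s q δ : ℝ} (hq : 0 < q) (hδ : 0 < δ) (β : ℝ) :
    ∫⁻ t in Ioi (0 : ℝ), ENNReal.ofReal (t ^ (2 * s - 1) * cutPow s (q + β * t - δ * t ^ 2)) =
      ∫⁻ ρ in Ioi (0 : ℝ), ENNReal.ofReal ((δ * ρ) ^ (-s) * (δ / q) /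
        (2 * √((β / (2 * q)) ^ 2 + δ / q * (1 + ρ)) *
          (√((β / (2 * q)) ^ 2 + δ / q * (1 + ρ)) - β / (2 * q)))) := by
  set m : ℝ := β / (2 * q) with hm
  set R : ℝ → ℝ := fun ρ => m ^ 2 + δ / q * (1 + ρ) with hR
  set ξ : ℝ → ℝ := fun ρ => √(R ρ) with hξ
  set S : Set ℝ := {t | 0 < t ∧ 0 < q + β * t - δ * t ^ 2} with hS
  have hβ : β = 2 * q * m := by rw [hm]; field_simp
  have hRpos : ∀ ρ ∈ Ioi (0 : ℝ), m ^ 2 < R ρ := fun ρ hρ => by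
    have h1 : 0 < 1 + ρ := by linarith [mem_Ioi.1 hρ]
    have : 0 < δ / q * (1 + ρ) := by positivity
    simp only [hR]; linarith
  have hξm : ∀ ρ ∈ Ioi (0 : ℝ), 0 < ξ ρ - m := fun ρ hρ => by
    have := Real.lt_sqrt_of_sq_lt (x := |m|) (by rw [sq_abs]; exact hRpos ρ hρ)
    have h2 := le_abs_self m
    simp only [hξ]; linarith
  have hξpos : ∀ ρ ∈ Ioi (0 : ℝ), 0 < ξ ρ := fun ρ hρ =>
    Real.sqrt_pos.2 ((sq_nonneg m).trans_lt (hRpos ρ hρ))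
  have hξsq : ∀ ρ ∈ Ioi (0 : ℝ), ξ ρ ^ 2 = m ^ 2 + δ / q * (1 + ρ) := fun ρ hρ =>
    Real.sq_sqrt ((sq_nonneg m).trans_lt (hRpos ρ hρ)).le
  set f : ℝ → ℝ := fun ρ => (ξ ρ - m)⁻¹ with hf
  have hfa : ∀ ρ ∈ Ioi (0 : ℝ), q + β * f ρ - δ * f ρ ^ 2 = f ρ ^ 2 * (δ * ρ) := fun ρ hρ => by
    have h1 := hξsq ρ hρ
    have h2 := (hξm ρ hρ).ne'
    have h3 : q * ξ ρ ^ 2 = q * m ^ 2 + δ * (1 + ρ) := by rw [h1]; field_simp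
    simp only [hf]
    rw [hβ]
    field_simp
    linear_combination h3
  have hfinj : InjOn f (Ioi 0) := fun ρ hρ ρ' hρ' h => by
    have h1 := hfa ρ hρ
    have h2 := hfa ρ' hρ'
    rw [← h] at h2
    have hpos : f ρ ≠ 0 := (inv_pos.2 (hξm ρ hρ)).ne'
    have h3 : f ρ ^ 2 * (δ * ρ) = f ρ ^ 2 * (δ * ρ') := h1.symm.trans h2
    have h4 := mul_left_cancel₀ (pow_ne_zero 2 hpos) h3
    exact mul_left_cancel₀ hδ.ne' h4
  -- The substitution is a bijection from the half-line onto the set where the quadratic is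
  -- positive; elsewhere the truncated power vanishes.
  have himg : f '' Ioi 0 = S := by
    ext t
    constructor
    · rintro ⟨ρ, hρ, rfl⟩
      have hpos : 0 < f ρ := inv_pos.2 (hξm ρ hρ)
      refine ⟨hpos, ?_⟩
      rw [hfa ρ hρ]
      have : 0 < ρ := hρ
      positivity
    · rintro ⟨ht, ha⟩
      refine ⟨(q + β * t - δ * t ^ 2) / (δ * t ^ 2), ?_, ?_⟩
      · exact div_pos ha (by positivity)
      · have h1 : R ((q + β * t - δ * t ^ 2) / (δ * t ^ 2)) = (t⁻¹ + m) ^ 2 := by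
          simp only [hR]; rw [hβ]; field_simp; ring
        have h2 : 0 ≤ t⁻¹ + m := by
          have h3 : 0 < 2 * q + β * t := by nlinarith [mul_pos hδ (pow_pos ht 2)]
          have : t⁻¹ + m = (2 * q + β * t) / (2 * q * t) := by rw [hm]; field_simp
          rw [this]; positivity
        simp only [hf, hξ, h1, Real.sqrt_sq h2]
        simp
  have hder : ∀ ρ ∈ Ioi (0 : ℝ), HasDerivWithinAt f
      (-(δ / q / (2 * ξ ρ)) / (ξ ρ - m) ^ 2) (Ioi 0) ρ := fun ρ hρ => by
    have h1 : HasDerivAt R (δ / q) ρ := by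
      have := (((hasDerivAt_id ρ).const_add 1).const_mul (δ / q)).const_add (m ^ 2)
      rwa [mul_one] at this
    have h2 := (h1.sqrt ((sq_nonneg m).trans_lt (hRpos ρ hρ)).ne').sub_const m
    exact (h2.fun_inv (hξm ρ hρ).ne').hasDerivWithinAt
  have hSmeas : MeasurableSet S := by
    apply MeasurableSet.inter measurableSet_Ioi
    exact measurableSet_lt measurable_const
      (by fun_prop : Measurable fun t : ℝ => q + β * t - δ * t ^ 2)
  have hred : ∫⁻ t in Ioi (0 : ℝ), ENNReal.ofReal (t ^ (2 * s - 1) *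
      cutPow s (q + β * t - δ * t ^ 2)) = ∫⁻ t in S, ENNReal.ofReal (t ^ (2 * s - 1) *
      cutPow s (q + β * t - δ * t ^ 2)) := by
    rw [← lintegral_indicator measurableSet_Ioi, ← lintegral_indicator hSmeas]
    congr 1
    ext t
    by_cases ht : 0 < t
    · by_cases ha : 0 < q + β * t - δ * t ^ 2
      · rw [indicator_of_mem (mem_Ioi.2 ht), indicator_of_mem (show t ∈ S from ⟨ht, ha⟩)]
      · rw [indicator_of_mem (mem_Ioi.2 ht), indicator_of_notMem (fun h : t ∈ S => ha h.2),
          cutPow_of_nonpos (not_lt.1 ha)]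
        simp
    · rw [indicator_of_notMem (fun h : t ∈ Ioi 0 => ht h), indicator_of_notMem (fun h : t ∈ S => ht h.1)]
  rw [hred, ← himg, lintegral_image_eq_lintegral_abs_deriv_mul measurableSet_Ioi hder hfinj]
  refine setLIntegral_congr_fun measurableSet_Ioi fun ρ hρ => ?_
  have hρ0 : 0 < ρ := hρ
  have hfp : 0 < f ρ := inv_pos.2 (hξm ρ hρ)
  have hx := hξpos ρ hρ
  have hxm := hξm ρ hρ
  rw [← ENNReal.ofReal_mul (abs_nonneg _)]
  congr 1
  rw [hfa ρ hρ, cutPow_of_pos (by positivity), Real.mul_rpow (by positivity) (by positivity),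
    neg_div, abs_neg, abs_of_pos (by positivity), ← Real.rpow_natCast (f ρ) 2, ← Real.rpow_mul hfp.le]
  have h5 : f ρ ^ (2 * s - 1) * (f ρ ^ (((2 : ℕ) : ℝ) * -s) * (δ * ρ) ^ (-s)) =
      (f ρ)⁻¹ * (δ * ρ) ^ (-s) := by
    rw [← mul_assoc, ← Real.rpow_add hfp, ← Real.rpow_neg_one]
    congr 2
    push_cast; ring
  rw [h5]
  have : (f ρ)⁻¹ = ξ ρ - m := by simp [hf]
  rw [this]
  change _ = (δ * ρ) ^ (-s) * (δ / q) / (2 * ξ ρ * (ξ ρ - m))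
  field_simp

/-- The two signs of `β` give the denominators `ξ - m` and `ξ + m`, whose reciprocals add up to `2ξ
/ (ξ² - m²)` with `ξ² - m² = (δ/q)(1 + ρ)`. Thus `q` and `β` drop out of the sum, which neither
integral achieves alone. -/
lemma lintegral_rpow_mul_cutPow_quadratic_add {s q δ : ℝ} (hq : 0 < q) (hδ : 0 < δ) (β : ℝ) :
    ∫⁻ t in Ioi (0 : ℝ), (ENNReal.ofReal (t ^ (2 * s - 1) * cutPow s (q + β * t - δ * t ^ 2)) +
      ENNReal.ofReal (t ^ (2 * s - 1) * cutPow s (q - β * t - δ * t ^ 2))) =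
      ENNReal.ofReal (δ ^ (-s)) * ∫⁻ ρ in Ioi (0 : ℝ), ENNReal.ofReal (ρ ^ (-s) / (1 + ρ)) := by
  rw [lintegral_add_left (by fun_prop)]
  have h2 := lintegral_rpow_mul_cutPow_quadratic (s := s) hq hδ (-β)
  simp only [neg_mul, neg_div, ← sub_eq_add_neg, neg_sq, sub_neg_eq_add] at h2
  rw [h2, lintegral_rpow_mul_cutPow_quadratic hq hδ β, ← lintegral_add_left (by fun_prop),
    ← lintegral_const_mul _ (by fun_prop)]
  refine setLIntegral_congr_fun measurableSet_Ioi fun ρ hρ => ?_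
  have hρ0 : 0 < ρ := hρ
  set m : ℝ := β / (2 * q) with hm
  set ξ : ℝ := √(m ^ 2 + δ / q * (1 + ρ)) with hξ
  have hpos : 0 < δ / q * (1 + ρ) := by positivity
  have hξsq : ξ ^ 2 = m ^ 2 + δ / q * (1 + ρ) := Real.sq_sqrt (by positivity)
  have hξm : |m| < ξ := Real.lt_sqrt_of_sq_lt (by rw [sq_abs]; linarith)
  have h1 : 0 < ξ - m := by linarith [le_abs_self m]
  have h3 : 0 < ξ + m := by linarith [neg_abs_le m]
  have hx : 0 < ξ := (abs_nonneg m).trans_lt hξm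
  rw [← ENNReal.ofReal_mul (by positivity), ← ENNReal.ofReal_add (by positivity) (by positivity)]
  congr 1
  rw [Real.mul_rpow hδ.le hρ0.le]
  have h4 : q * ((ξ - m) * (ξ + m)) = δ * (1 + ρ) := by
    have : q * ξ ^ 2 = q * m ^ 2 + δ * (1 + ρ) := by rw [hξsq]; field_simp
    linear_combination this
  have h5 : δ / q / (2 * ξ * (ξ - m)) + δ / q / (2 * ξ * (ξ + m)) = 1 / (1 + ρ) := by
    field_simp
    linear_combination -(2 : ℝ) * ξ * h4
  have h6 : (1 + ρ) ≠ 0 := by positivity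
  calc _ = δ ^ (-s) * ρ ^ (-s) * (δ / q / (2 * ξ * (ξ - m)) + δ / q / (2 * ξ * (ξ + m))) := by ring
    _ = _ := by rw [h5]; ring

lemma cutPow_mul {s c : ℝ} (hc : 0 < c) (a : ℝ) : cutPow s (c * a) = c ^ (-s) * cutPow s a := by
  by_cases ha : 0 < a
  · rw [cutPow_of_pos ha, cutPow_of_pos (by positivity), Real.mul_rpow hc.le ha.le]
  · rw [cutPow_of_nonpos (not_lt.1 ha), cutPow_of_nonpos
      (mul_nonpos_of_nonneg_of_nonpos hc.le (not_lt.1 ha)), mul_zero]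

/-! ### The Riesz potential of the Poisson kernel of a ball -/

section
variable {E : Type*} [NormedAddCommGroup E] [InnerProductSpace ℝ E] [FiniteDimensional ℝ E]
  [MeasurableSpace E] [BorelSpace E]

open Module

lemma lintegral_polar [Nontrivial E] {g : E → ENNReal} (hg : Measurable g) :
    ∫⁻ x, g x = ∫⁻ θ, (∫⁻ r in Ioi (0 : ℝ), ENNReal.ofReal (r ^ (finrank ℝ E - 1)) *
      g (r • (θ : E))) ∂(volume : Measure E).toSphere := by
  have hmp := (volume : Measure E).measurePreserving_homeomorphUnitSphereProd
  have h1 : ∫⁻ x, g x = ∫⁻ x : ({0}ᶜ : Set E), g x ∂(volume.comap Subtype.val) := by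
    rw [lintegral_subtype_comap (measurableSet_singleton _).compl,
      restrict_compl_singleton]
  have h2 : ∫⁻ x : ({0}ᶜ : Set E), g x ∂(volume.comap Subtype.val) =
      ∫⁻ p, g ((p.2 : ℝ) • (p.1 : E)) ∂((volume : Measure E).toSphere.prod
        (Measure.volumeIoiPow (finrank ℝ E - 1))) := by
    rw [← hmp.lintegral_comp_emb (Homeomorph.measurableEmbedding _)]
    refine lintegral_congr fun x => ?_
    have hx : ‖(x : E)‖ ≠ 0 := norm_ne_zero_iff.2 x.2
    simp [smul_smul, hx]
  rw [h1, h2, lintegral_prod _ (by fun_prop)]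
  refine lintegral_congr fun θ => ?_
  rw [Measure.volumeIoiPow, lintegral_withDensity_eq_lintegral_mul _ (by fun_prop) (by fun_prop)]
  exact lintegral_subtype_comap measurableSet_Ioi
    (fun r : ℝ => ENNReal.ofReal (r ^ (finrank ℝ E - 1)) * g (r • (θ : E)))

lemma lintegral_eq_lintegral_inversion [Nontrivial E] (g : E → ENNReal) :
    ∫⁻ x, g x = ∫⁻ w, ENNReal.ofReal ((‖w‖⁻¹ ^ 2) ^ finrank ℝ E) * g ((‖w‖⁻¹ ^ 2) • w) := by
  have hinj : InjOn (EuclideanGeometry.inversion (0 : E) 1) {0}ᶜ :=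
    (EuclideanGeometry.inversion_injective _ one_ne_zero).injOn
  have himg : EuclideanGeometry.inversion (0 : E) 1 '' {0}ᶜ = {0}ᶜ := by
    rw [image_compl_eq (EuclideanGeometry.inversion_bijective _ one_ne_zero)]
    simp
  have h := lintegral_image_eq_lintegral_abs_det_fderiv_mul volume
    (measurableSet_singleton (0 : E)).compl
    (fun x hx => (EuclideanGeometry.hasFDerivAt_inversion (R := 1) hx).hasFDerivWithinAt) hinj g
  rw [himg, restrict_compl_singleton] at h
  rw [h]
  refine lintegral_congr fun w => ?_
  -- The derivative of the inversion is `‖w‖⁻²` times a reflection, so its determinant is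
  -- `±‖w‖^{-2d}`.
  have hdet : |(((1 / dist w 0) ^ 2 • ((ℝ ∙ (w - 0))ᗮ.reflection : E →L[ℝ] E))).det| =
      (‖w‖⁻¹ ^ 2) ^ finrank ℝ E := by
    have h1 : (((ℝ ∙ (w - 0))ᗮ.reflection : E →L[ℝ] E)).det = (-1) ^ finrank ℝ (ℝ ∙ (w - 0))ᗮᗮ :=
      (ℝ ∙ (w - 0))ᗮ.det_reflection
    rw [ContinuousLinearMap.det] at h1 ⊢
    rw [ContinuousLinearMap.toLinearMap_smul, LinearMap.det_smul, h1, abs_mul, abs_pow (-1 : ℝ)]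
    simp
  rw [hdet]
  congr 2
  simp [EuclideanGeometry.inversion]

/-- The integral of the Riesz kernel of order `2 s` against the truncated power `-s` of a quadratic
polynomial, up to the power of the leading coefficient. -/
noncomputable def rieszBallConst (E : Type*) [NormedAddCommGroup E] [InnerProductSpace ℝ E]
    [FiniteDimensional ℝ E] [MeasurableSpace E] [BorelSpace E] (s : ℝ) : ENNReal :=
  2⁻¹ * ((volume : Measure E).toSphere univ *
    ∫⁻ ρ in Ioi (0 : ℝ), ENNReal.ofReal (ρ ^ (-s) / (1 + ρ)))

/-- Averaging over `w` and `-w` and passing to polar coordinates reduces each direction to the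
one-dimensional identity for `±β`. The radial integral is then the same in every direction,
independent of `q` and `b`; the averaging accounts for the factor `2⁻¹` in `rieszBallConst`. -/
lemma lintegral_riesz_mul_cutPow_quadratic [Nontrivial E] {s q δ : ℝ} (hq : 0 < q) (hδ : 0 < δ)
    (b : E) :
    ∫⁻ w : E, ENNReal.ofReal (cutPow s (q + inner ℝ b w - δ * ‖w‖ ^ 2) *
      ‖w‖ ^ (2 * s - finrank ℝ E)) = ENNReal.ofReal (δ ^ (-s)) * rieszBallConst E s := by
  set F : E → ENNReal := fun w => ENNReal.ofReal (cutPow s (q + inner ℝ b w - δ * ‖w‖ ^ 2) *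
      ‖w‖ ^ (2 * s - finrank ℝ E)) with hF
  have hFm : Measurable F := by fun_prop
  have hneg : ∫⁻ w, F w = ∫⁻ w, F (-w) :=
    (lintegral_neg_eq_self F).symm
  have h2 : 2 * ∫⁻ w, F w = ∫⁻ w, (F w + F (-w)) := by
    rw [lintegral_add_left hFm, ← hneg, two_mul]
  have hd : 0 < finrank ℝ E := finrank_pos
  have h3 : ∫⁻ w, (F w + F (-w)) = (volume : Measure E).toSphere univ *
      (ENNReal.ofReal (δ ^ (-s)) *
        ∫⁻ ρ in Ioi (0 : ℝ), ENNReal.ofReal (ρ ^ (-s) / (1 + ρ))) := by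
    rw [lintegral_polar (by fun_prop)]
    trans ∫⁻ θ, (ENNReal.ofReal (δ ^ (-s)) *
        ∫⁻ ρ in Ioi (0 : ℝ), ENNReal.ofReal (ρ ^ (-s) / (1 + ρ))) ∂(volume : Measure E).toSphere
    · refine lintegral_congr fun θ => ?_
      rw [← lintegral_rpow_mul_cutPow_quadratic_add hq hδ (inner ℝ b (θ : E))]
      refine setLIntegral_congr_fun measurableSet_Ioi fun r hr => ?_
      have hr0 : 0 < r := hr
      have hθ : ‖(θ : E)‖ = 1 := norm_eq_of_mem_sphere θ
      simp only [hF]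
      rw [mul_add, ← ENNReal.ofReal_mul (by positivity), ← ENNReal.ofReal_mul (by positivity)]
      have hpow : r ^ (finrank ℝ E - 1) * r ^ (2 * s - finrank ℝ E) = r ^ (2 * s - 1) := by
        rw [← Real.rpow_natCast, ← Real.rpow_add hr0, Nat.cast_pred hd]
        congr 1; ring
      simp only [norm_neg, norm_smul, Real.norm_eq_abs, abs_of_pos hr0, hθ, mul_one,
        inner_neg_right, inner_smul_right]
      congr 2
      · rw [← hpow]; ring_nf
      · rw [← hpow]; ring_nf
    · rw [lintegral_const, mul_comm]
  have h4 : ∫⁻ w, F w = 2⁻¹ * (2 * ∫⁻ w, F w) := by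
    rw [← mul_assoc, ENNReal.inv_mul_cancel (by simp) (by simp), one_mul]
  rw [h4, h2, h3, rieszBallConst]
  ring

/-- The Riesz potential of the Poisson kernel of a ball at points outside the ball. -/
lemma lintegral_cutPow_mul_riesz [Nontrivial E] {s lam : ℝ} {x y : E}
    (hx : ‖x‖ ^ 2 < lam) (hy : lam < ‖y‖ ^ 2) :
    ∫⁻ z : E, ENNReal.ofReal (cutPow s (‖z‖ ^ 2 - lam) * ‖x - z‖ ^ (-(finrank ℝ E : ℝ)) *
      ‖z - y‖ ^ (2 * s - finrank ℝ E)) =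
      ENNReal.ofReal ((lam - ‖x‖ ^ 2) ^ (-s) * ‖x - y‖ ^ (2 * s - finrank ℝ E)) *
        rieszBallConst E s := by
  set d := finrank ℝ E with hd
  set G : E → ENNReal := fun z => ENNReal.ofReal (cutPow s (‖z‖ ^ 2 - lam) *
    ‖x - z‖ ^ (-(d : ℝ)) * ‖z - y‖ ^ (2 * s - d)) with hG
  set δ := lam - ‖x‖ ^ 2 with hδ
  have hδ0 : 0 < δ := sub_pos.2 hx
  have hxy : y - x ≠ 0 := sub_ne_zero.2 fun h => by rw [h] at hy; linarith
  set η := y - x with hη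
  have hηn : 0 < ‖η‖ := norm_pos_iff.2 hxy
  -- The point `v` is the image of `y` under the inversion centred at `x`, after moving `x` to the
  -- origin. In inverted coordinates the Riesz kernel has its pole at `v`.
  set v : E := (‖η‖⁻¹ ^ 2) • η with hv
  have hvn : ‖v‖ = ‖η‖⁻¹ := by
    rw [hv, norm_smul, Real.norm_of_nonneg (by positivity)]
    field_simp
  have hyn : ‖y‖ ^ 2 = ‖x‖ ^ 2 + 2 * inner ℝ x η + ‖η‖ ^ 2 := by
    rw [← norm_add_sq_real, hη, add_sub_cancel]
  -- This constant term of the quadratic re-centred at `v` is positive exactly because `y` lies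
  -- outside the ball.
  have hq : 0 < 1 + 2 * inner ℝ x v - δ * ‖v‖ ^ 2 := by
    have : 1 + 2 * inner ℝ x v - δ * ‖v‖ ^ 2 = ‖η‖⁻¹ ^ 2 * (‖y‖ ^ 2 - lam) := by
      rw [hvn, hv, inner_smul_right, hyn, hδ]
      field_simp
      ring
    rw [this]
    have : 0 < ‖y‖ ^ 2 - lam := sub_pos.2 hy
    positivity
  have hQ := lintegral_riesz_mul_cutPow_quadratic (s := s) hq hδ0 ((2 : ℝ) • x - (2 * δ) • v)
  set H : E → ENNReal := fun w => ENNReal.ofReal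
    (cutPow s (1 + 2 * inner ℝ x w - δ * ‖w‖ ^ 2) * ‖w - v‖ ^ (2 * s - d)) with hH
  have hHint : ∫⁻ w, H w = ENNReal.ofReal (δ ^ (-s)) * rieszBallConst E s := by
    rw [← hQ, ← lintegral_add_right_eq_self H v]
    refine lintegral_congr fun w => ?_
    simp only [hH, add_sub_cancel_right, inner_add_right, inner_sub_left, inner_smul_left,
      norm_add_sq_real, real_inner_comm w v, RCLike.conj_to_real]
    congr 3
    ring
  rw [← lintegral_add_right_eq_self G x, lintegral_eq_lintegral_inversion,
    ENNReal.ofReal_mul (by positivity), mul_right_comm, ← hHint, mul_comm,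
    ← lintegral_const_mul _ (by fun_prop)]
  have hne : ∀ᵐ w : E, w ≠ 0 := by
    simp [ae_iff]
  refine lintegral_congr_ae ?_
  filter_upwards [hne] with w hw
  have hwn : 0 < ‖w‖ := norm_pos_iff.2 hw
  simp only [hG, hH]
  rw [← ENNReal.ofReal_mul (by positivity), ← ENNReal.ofReal_mul (by positivity)]
  congr 1
  have e1 : ‖(‖w‖⁻¹ ^ 2) • w + x‖ ^ 2 - lam =
      ‖w‖⁻¹ ^ 2 * (1 + 2 * inner ℝ x w - δ * ‖w‖ ^ 2) := by
    rw [norm_add_sq_real, norm_smul, inner_smul_left, real_inner_comm, hδ]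
    simp only [Real.norm_eq_abs, abs_pow, abs_inv, abs_norm, RCLike.conj_to_real]
    field_simp
    ring
  have e2 : ‖x - ((‖w‖⁻¹ ^ 2) • w + x)‖ = ‖w‖⁻¹ := by
    rw [sub_add_cancel_right, norm_neg, norm_smul, Real.norm_of_nonneg (by positivity)]
    field_simp
  have e3 : ‖(‖w‖⁻¹ ^ 2) • w + x - y‖ = ‖w‖⁻¹ * ‖η‖ * ‖w - v‖ := by
    have h1 : dist (EuclideanGeometry.inversion 0 1 w) (EuclideanGeometry.inversion 0 1 v) =
        1 ^ 2 / (dist w 0 * dist v 0) * dist w v :=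
      EuclideanGeometry.dist_inversion_inversion hw
        (by rw [← norm_ne_zero_iff, hvn]; positivity) 1
    have h2 : EuclideanGeometry.inversion 0 1 w = (‖w‖⁻¹ ^ 2) • w := by
      simp [EuclideanGeometry.inversion]
    have h3 : EuclideanGeometry.inversion 0 1 v = η := by
      have : v = EuclideanGeometry.inversion 0 1 η := by simp [EuclideanGeometry.inversion, hv]
      rw [this, EuclideanGeometry.inversion_inversion _ one_ne_zero]
    rw [h2, h3] at h1
    simp only [dist_eq_norm, sub_zero, hvn] at h1
    have h4 : (‖w‖⁻¹ ^ 2) • w + x - y = (‖w‖⁻¹ ^ 2) • w - η := by rw [hη]; abel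
    rw [h4, h1]
    field_simp
  have e4 : ‖x - y‖ = ‖η‖ := by rw [hη, norm_sub_rev]
  rw [e1, e2, e3, e4, cutPow_mul (by positivity), Real.mul_rpow (by positivity) (by positivity),
    Real.mul_rpow (by positivity) (by positivity)]
  -- The powers of `‖w‖` from the Jacobian, the truncated power and the two kernels cancel: `2d - 2s
  -- - d + (2s - d) = 0`.
  have e5 : (‖w‖⁻¹ ^ 2) ^ d * ((‖w‖⁻¹ ^ 2) ^ (-s) * ‖w‖⁻¹ ^ (-(d : ℝ)) *
      ‖w‖⁻¹ ^ (2 * s - d)) = 1 := by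
    have hi : 0 < ‖w‖⁻¹ := by positivity
    rw [← Real.rpow_natCast (‖w‖⁻¹ ^ 2) d, ← Real.rpow_natCast ‖w‖⁻¹ 2, ← Real.rpow_mul hi.le,
      ← Real.rpow_mul hi.le, ← Real.rpow_add hi, ← Real.rpow_add hi, ← Real.rpow_add hi]
    push_cast
    ring_nf
    exact Real.rpow_zero _
  linear_combination (cutPow s (1 + 2 * inner ℝ x w - δ * ‖w‖ ^ 2) * ‖η‖ ^ (2 * s - d) *
    ‖w - v‖ ^ (2 * s - d)) * e5
end

/-! ### Averaging over radii: bounds for the weight and its normalisation -/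

lemma lintegral_rpow_neg_Ioc_lt_top {s : ℝ} (hs1 : s < 1) :
    ∫⁻ ρ in Ioc (0 : ℝ) 1, ENNReal.ofReal (ρ ^ (-s)) < ⊤ := by
  have h : IntegrableOn (fun ρ : ℝ => ρ ^ (-s)) (Ioc 0 1) :=
    (intervalIntegral.intervalIntegrable_rpow' (by linarith)).1
  exact h.lintegral_lt_top

lemma lintegral_rpow_neg_div_one_add_lt_top {s : ℝ} (hs0 : 0 < s) (hs1 : s < 1) :
    ∫⁻ ρ in Ioi (0 : ℝ), ENNReal.ofReal (ρ ^ (-s) / (1 + ρ)) < ⊤ := by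
  rw [← Ioc_union_Ioi_eq_Ioi zero_le_one]
  refine (lintegral_union_le _ _ _).trans_lt (ENNReal.add_lt_top.2 ⟨?_, ?_⟩)
  · refine (setLIntegral_mono' measurableSet_Ioc fun ρ hρ => ?_).trans_lt
      (lintegral_rpow_neg_Ioc_lt_top hs1)
    have := hρ.1
    exact ENNReal.ofReal_le_ofReal (div_le_self (by positivity) (by linarith))
  · have h : IntegrableOn (fun ρ : ℝ => ρ ^ (-s - 1)) (Ioi 1) :=
      integrableOn_Ioi_rpow_of_lt (by linarith) one_pos
    refine (setLIntegral_mono' measurableSet_Ioi fun ρ hρ => ?_).trans_lt h.lintegral_lt_top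
    have h0 : 0 < ρ := one_pos.trans hρ
    refine ENNReal.ofReal_le_ofReal ?_
    rw [Real.rpow_sub h0, Real.rpow_one]
    gcongr
    linarith

lemma lintegral_rpow_neg_div_one_add_ne_zero (s : ℝ) :
    ∫⁻ ρ in Ioi (0 : ℝ), ENNReal.ofReal (ρ ^ (-s) / (1 + ρ)) ≠ 0 := by
  rw [← pos_iff_ne_zero, setLIntegral_pos_iff (by fun_prop)]
  have : Ioi (0 : ℝ) ⊆ (Function.support fun ρ : ℝ => ENNReal.ofReal (ρ ^ (-s) / (1 + ρ))) ∩
      Ioi 0 := fun ρ hρ => by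
    have h0 : (0 : ℝ) < ρ := hρ
    refine ⟨?_, hρ⟩
    rw [Function.mem_support, ENNReal.ofReal_ne_zero_iff]
    positivity
  exact (by simp : (0 : ENNReal) < volume (Ioi (0 : ℝ))).trans_le (measure_mono this)

/-- The truncated powers `(t - λ)₊^{-s}` averaged over `λ ∈ [a, b]`. -/
noncomputable def poissonWeight (s a b t : ℝ) : ENNReal :=
  ∫⁻ lam in Icc a b, ENNReal.ofReal (cutPow s (t - lam))

@[fun_prop]
lemma measurable_poissonWeight (s a b : ℝ) : Measurable (poissonWeight s a b) :=
  Measurable.lintegral_prod_right' (f := fun p : ℝ × ℝ => ENNReal.ofReal (cutPow s (p.1 - p.2)))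
    (by fun_prop)

lemma poissonWeight_eq_zero {s a b t : ℝ} (ht : t ≤ a) : poissonWeight s a b t = 0 := by
  rw [poissonWeight, setLIntegral_congr_fun (g := fun _ => 0) measurableSet_Icc, lintegral_zero]
  intro lam hlam
  simp [cutPow_of_nonpos (show t - lam ≤ 0 by linarith [hlam.1])]

/-- This bound, uniform in `t`, is the gain from averaging: the singularity of exponent `-s > -1` is
integrable in `λ`. It is split off on `0 < t - λ ≤ 1`, and elsewhere the truncated power is at most
`1`. -/
lemma poissonWeight_le {s a b : ℝ} (hs0 : 0 < s) (t : ℝ) : poissonWeight s a b t ≤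
    ENNReal.ofReal (b - a) + ∫⁻ ρ in Ioc (0 : ℝ) 1, ENNReal.ofReal (ρ ^ (-s)) := by
  have h1 : ∀ lam, ENNReal.ofReal (cutPow s (t - lam)) ≤ 1 +
      (Ioc (0 : ℝ) 1).indicator (fun ρ => ENNReal.ofReal (ρ ^ (-s))) (t - lam) := fun lam => by
    by_cases h0 : 0 < t - lam
    · rw [cutPow_of_pos h0]
      by_cases h2 : t - lam ≤ 1
      · rw [indicator_of_mem (show t - lam ∈ Ioc (0 : ℝ) 1 from ⟨h0, h2⟩)]
        exact le_add_self
      · refine le_trans ?_ le_self_add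
        rw [← ENNReal.ofReal_one]
        exact ENNReal.ofReal_le_ofReal
          (Real.rpow_le_one_of_one_le_of_nonpos (not_le.1 h2).le (by linarith))
    · simp [cutPow_of_nonpos (not_lt.1 h0)]
  calc poissonWeight s a b t ≤ ∫⁻ lam in Icc a b, (1 +
      (Ioc (0 : ℝ) 1).indicator (fun ρ => ENNReal.ofReal (ρ ^ (-s))) (t - lam)) :=
        lintegral_mono h1
    _ = ENNReal.ofReal (b - a) + ∫⁻ lam in Icc a b,
      (Ioc (0 : ℝ) 1).indicator (fun ρ => ENNReal.ofReal (ρ ^ (-s))) (t - lam) := by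
        rw [lintegral_add_left (by fun_prop)]; simp
    _ ≤ ENNReal.ofReal (b - a) + ∫⁻ lam,
      (Ioc (0 : ℝ) 1).indicator (fun ρ => ENNReal.ofReal (ρ ^ (-s))) (t - lam) := by
        gcongr; exact Measure.restrict_le_self
    _ = _ := by rw [lintegral_sub_left_eq_self, lintegral_indicator measurableSet_Ioc]

lemma poissonWeight_lt_top {s : ℝ} (a b : ℝ) (hs0 : 0 < s) (hs1 : s < 1) (t : ℝ) :
    poissonWeight s a b t < ⊤ :=
  (poissonWeight_le hs0 t).trans_lt
    (ENNReal.add_lt_top.2 ⟨ENNReal.ofReal_lt_top, lintegral_rpow_neg_Ioc_lt_top hs1⟩)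

lemma poissonWeight_le_of_lt {s a b t : ℝ} (hs0 : 0 < s) (ht : b < t) :
    poissonWeight s a b t ≤ ENNReal.ofReal ((t - b) ^ (-s)) * ENNReal.ofReal (b - a) := by
  calc poissonWeight s a b t ≤ ∫⁻ lam in Icc a b, ENNReal.ofReal ((t - b) ^ (-s)) := by
        refine setLIntegral_mono' measurableSet_Icc fun lam hlam => ENNReal.ofReal_le_ofReal ?_
        rw [cutPow_of_pos (by linarith [hlam.2])]
        exact Real.rpow_le_rpow_of_nonpos (by linarith) (by linarith [hlam.2]) (by linarith)
    _ = _ := by simp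

/-- For `t ≤ 2b` the uniform bound suffices; for `t > 2b` every `t - λ` is at least `t / 2`, which
gives the decay `t^{-s}`. -/
lemma exists_toReal_poissonWeight_le {s a b : ℝ} (hs0 : 0 < s) (hs1 : s < 1) (ha : 0 < a)
    (hab : a < b) :
    ∃ K, 0 ≤ K ∧ ∀ t, a < t → (poissonWeight s a b t).toReal ≤ K * t ^ (-s) := by
  set K₁ := (ENNReal.ofReal (b - a) + ∫⁻ ρ in Ioc (0 : ℝ) 1, ENNReal.ofReal (ρ ^ (-s))).toReal
    with hK₁
  have hK₁0 : 0 ≤ K₁ := ENNReal.toReal_nonneg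
  have hb : 0 < b := ha.trans hab
  have hba : 0 < b - a := sub_pos.2 hab
  refine ⟨K₁ * (2 * b) ^ s + 2 ^ s * (b - a), by positivity, fun t ht => ?_⟩
  have ht0 : 0 < t := ha.trans ht
  rw [add_mul]
  rcases le_or_gt t (2 * b) with h | h
  · have h1 : (poissonWeight s a b t).toReal ≤ K₁ :=
      ENNReal.toReal_mono (ENNReal.add_lt_top.2 ⟨ENNReal.ofReal_lt_top,
        lintegral_rpow_neg_Ioc_lt_top hs1⟩).ne (poissonWeight_le hs0 t)
    have h2 : 1 ≤ (2 * b) ^ s * t ^ (-s) := by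
      rw [Real.rpow_neg ht0.le, ← div_eq_mul_inv, one_le_div (by positivity)]
      exact Real.rpow_le_rpow ht0.le h hs0.le
    have h3 : 0 ≤ 2 ^ s * (b - a) * t ^ (-s) := by positivity
    nlinarith [mul_le_mul_of_nonneg_left h2 hK₁0]
  · have h1 := ENNReal.toReal_mono (by finiteness)
      (poissonWeight_le_of_lt (a := a) hs0 (show b < t by linarith))
    rw [ENNReal.toReal_mul, ENNReal.toReal_ofReal hba.le,
      ENNReal.toReal_ofReal (Real.rpow_nonneg (by linarith) _)] at h1
    have h2 : (t - b) ^ (-s) ≤ 2 ^ s * t ^ (-s) := by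
      have : 2 ^ s * t ^ (-s) = (t / 2) ^ (-s) := by
        rw [Real.div_rpow ht0.le (by norm_num), Real.rpow_neg (by norm_num : (0 : ℝ) ≤ 2)]
        field_simp
      rw [this]
      exact Real.rpow_le_rpow_of_nonpos (by linarith) (by linarith) (by linarith)
    have h3 : 0 ≤ K₁ * (2 * b) ^ s * t ^ (-s) := by positivity
    nlinarith [mul_le_mul_of_nonneg_right h2 hba.le]

/-- The normalisation `∫_a^b (λ - t)^{-s} dλ` of the averaged Poisson kernel. -/
noncomputable def poissonNorm (s a b t : ℝ) : ℝ :=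
  ((b - t) ^ (1 - s) - (a - t) ^ (1 - s)) / (1 - s)

lemma lintegral_Icc_rpow_sub {s a b t : ℝ} (hs1 : s < 1) (hab : a ≤ b) (ht : t < a) :
    ∫⁻ lam in Icc a b, ENNReal.ofReal ((lam - t) ^ (-s)) =
      ENNReal.ofReal (poissonNorm s a b t) := by
  have hcont : ContinuousOn (fun lam => (lam - t) ^ (-s)) (Icc a b) :=
    ContinuousOn.rpow_const (by fun_prop) fun x hx => Or.inl (by linarith [hx.1])
  rw [← ofReal_integral_eq_lintegral_ofReal hcont.integrableOn_Icc
    ((ae_restrict_mem measurableSet_Icc).mono fun x hx =>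
      Real.rpow_nonneg (by linarith [hx.1]) _), integral_Icc_eq_integral_Ioc,
    ← intervalIntegral.integral_of_le hab,
    intervalIntegral.integral_comp_sub_right (fun x => x ^ (-s)),
    integral_rpow (Or.inl (by linarith)), poissonNorm]
  ring_nf

lemma poissonNorm_pos {s a b t : ℝ} (hs1 : s < 1) (hab : a < b) (ht : t < a) :
    0 < poissonNorm s a b t :=
  div_pos (sub_pos.2 (Real.rpow_lt_rpow (by linarith) (by linarith) (by linarith))) (by linarith)

lemma poissonNorm_nonneg {s a b t : ℝ} (hs1 : s < 1) (hab : a ≤ b) (ht : t < a) :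
    0 ≤ poissonNorm s a b t :=
  div_nonneg (sub_nonneg.2 (Real.rpow_le_rpow (by linarith) (by linarith) (by linarith)))
    (by linarith)

section
variable {E : Type*} [NormedAddCommGroup E] [InnerProductSpace ℝ E] [FiniteDimensional ℝ E]
  [MeasurableSpace E] [BorelSpace E]

open Module

lemma rieszBallConst_ne_top {s : ℝ} (hs0 : 0 < s) (hs1 : s < 1) : rieszBallConst E s ≠ ⊤ :=
  ENNReal.mul_ne_top (by simp) (ENNReal.mul_ne_top (measure_ne_top _ _)
    (lintegral_rpow_neg_div_one_add_lt_top hs0 hs1).ne)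

lemma rieszBallConst_ne_zero [Nontrivial E] (s : ℝ) : rieszBallConst E s ≠ 0 :=
  mul_ne_zero (by simp) (mul_ne_zero (Measure.measure_univ_ne_zero.2 (Measure.toSphere_ne_zero _))
    (lintegral_rpow_neg_div_one_add_ne_zero s))

/-- The Riesz potential of the averaged Poisson kernel at points outside the balls. -/
lemma lintegral_poissonWeight_mul_riesz [Nontrivial E] {s a b : ℝ} {x y : E} (hs1 : s < 1)
    (hab : a ≤ b) (hx : ‖x‖ ^ 2 < a) (hy : b < ‖y‖ ^ 2) :
    ∫⁻ z : E, poissonWeight s a b (‖z‖ ^ 2) * ENNReal.ofReal (‖x - z‖ ^ (-(finrank ℝ E : ℝ)) *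
      ‖z - y‖ ^ (2 * s - finrank ℝ E)) =
      ENNReal.ofReal (poissonNorm s a b (‖x‖ ^ 2) * ‖x - y‖ ^ (2 * s - finrank ℝ E)) *
        rieszBallConst E s := by
  have h1 : ∀ z : E, poissonWeight s a b (‖z‖ ^ 2) * ENNReal.ofReal
      (‖x - z‖ ^ (-(finrank ℝ E : ℝ)) * ‖z - y‖ ^ (2 * s - finrank ℝ E)) =
      ∫⁻ lam in Icc a b, ENNReal.ofReal (cutPow s (‖z‖ ^ 2 - lam) *
        ‖x - z‖ ^ (-(finrank ℝ E : ℝ)) * ‖z - y‖ ^ (2 * s - finrank ℝ E)) := fun z => by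
    rw [poissonWeight, ← lintegral_mul_const _ (by fun_prop)]
    refine lintegral_congr fun lam => ?_
    rw [← ENNReal.ofReal_mul (cutPow_nonneg _ _), mul_assoc]
  simp_rw [h1]
  rw [lintegral_lintegral_swap (by fun_prop), setLIntegral_congr_fun measurableSet_Icc
    (fun lam hlam => lintegral_cutPow_mul_riesz (hx.trans_le hlam.1) (hlam.2.trans_lt hy)),
    lintegral_mul_const _ (by fun_prop)]
  congr 1
  rw [ENNReal.ofReal_mul (poissonNorm_nonneg hs1 hab hx), ← lintegral_Icc_rpow_sub hs1 hab hx,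
    ← lintegral_mul_const _ (by fun_prop)]
  refine setLIntegral_congr_fun measurableSet_Icc fun lam hlam => ?_
  exact ENNReal.ofReal_mul (Real.rpow_nonneg (by linarith [hlam.1]) _)

/-- Points `x` with `‖x‖ ≤ r < √a` stay at distance at least `κ ‖z‖` from any `z` carrying weight,
where `κ = 1 - r / √a`. The kernel therefore decays like `‖z‖^{-d} (‖z‖²)^{-s}`, the rate required
by `L^∞_s`, uniformly in `x`. -/
lemma exists_norm_rpow_mul_poissonWeight_le {s a b r : ℝ} (hs0 : 0 < s) (hs1 : s < 1)
    (ha : 0 < a) (hab : a < b) (hr0 : 0 ≤ r) (hr : r ^ 2 < a) :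
    ∃ K, 0 ≤ K ∧ ∀ x z : E, ‖x‖ ≤ r → ‖x - z‖ ^ (-(finrank ℝ E : ℝ)) *
      (poissonWeight s a b (‖z‖ ^ 2)).toReal ≤ K / (1 + ‖z‖ ^ ((finrank ℝ E : ℝ) + 2 * s)) := by
  obtain ⟨K, hK, hKM⟩ := exists_toReal_poissonWeight_le hs0 hs1 ha hab
  set d : ℝ := (finrank ℝ E : ℝ) with hd
  have hd0 : 0 ≤ d := Nat.cast_nonneg _
  have hra : r < √a := Real.lt_sqrt_of_sq_lt hr
  have hsa : 0 < √a := Real.sqrt_pos.2 ha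
  set κ := 1 - r / √a with hκ
  have hκ0 : 0 < κ := sub_pos.2 ((div_lt_one hsa).2 hra)
  refine ⟨κ ^ (-d) * K * (1 + √a ^ (-(d + 2 * s))), by positivity, fun x z hx => ?_⟩
  rcases le_or_gt (‖z‖ ^ 2) a with h | h
  · rw [poissonWeight_eq_zero h, ENNReal.toReal_zero, mul_zero]
    positivity
  · have hz : √a < ‖z‖ := (Real.sqrt_lt' (by
      by_contra h0
      have : ‖z‖ = 0 := le_antisymm (not_lt.1 h0) (norm_nonneg _)
      rw [this] at h; norm_num at h; linarith)).2 h
    have hz0 : 0 < ‖z‖ := hsa.trans hz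
    have h1 : κ * ‖z‖ ≤ ‖x - z‖ := by
      have h2 : r ≤ r / √a * ‖z‖ := by
        rw [div_mul_eq_mul_div, le_div_iff₀ hsa]
        gcongr
      have h3 := norm_sub_norm_le z x
      rw [norm_sub_rev] at h3
      rw [hκ, sub_mul]
      linarith
    have h2 : ‖x - z‖ ^ (-d) ≤ κ ^ (-d) * ‖z‖ ^ (-d) := by
      rw [← Real.mul_rpow hκ0.le hz0.le]
      exact Real.rpow_le_rpow_of_nonpos (by positivity) h1 (by linarith)
    have h3 := hKM _ h
    have h4 : (‖z‖ ^ 2) ^ (-s) = ‖z‖ ^ (-(2 * s)) := by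
      rw [← Real.rpow_natCast, ← Real.rpow_mul hz0.le]; push_cast; ring_nf
    rw [h4] at h3
    calc _ ≤ (κ ^ (-d) * ‖z‖ ^ (-d)) * (K * ‖z‖ ^ (-(2 * s))) := by gcongr
      _ = κ ^ (-d) * K * ‖z‖ ^ (-(d + 2 * s)) := by
        rw [neg_add, Real.rpow_add hz0]; ring
      _ ≤ κ ^ (-d) * K * ((1 + √a ^ (-(d + 2 * s))) / (1 + ‖z‖ ^ (d + 2 * s))) := by
        gcongr
        rw [le_div_iff₀ (by positivity), mul_add, mul_one, ← Real.rpow_add hz0, neg_add_cancel,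
          Real.rpow_zero, add_comm]
        gcongr 1 + ?_
        exact Real.rpow_le_rpow_of_nonpos hsa hz.le (by linarith)
      _ = _ := by ring
end

/-! ### Integrability of Riesz kernels and of symmetric second differences -/

section
variable {E : Type*} [NormedAddCommGroup E] [InnerProductSpace ℝ E] [FiniteDimensional ℝ E]
  [MeasurableSpace E] [BorelSpace E]

open Module

lemma integrableOn_ball_norm_rpow [Nontrivial E] {p : ℝ} (hp : 0 < p) :
    IntegrableOn (fun x : E => ‖x‖ ^ (p - finrank ℝ E)) (Metric.ball 0 1) := by
  rw [integrableOn_fun_norm_addHaar volume (f := fun r : ℝ => r ^ (p - finrank ℝ E))]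
  have h : IntegrableOn (fun r : ℝ => r ^ (p - 1)) (Ioo 0 1) :=
    (intervalIntegral.intervalIntegrable_rpow' (by linarith) (a := 0) (b := 1)).1.mono_set
      Ioo_subset_Ioc_self
  refine h.congr_fun (fun r hr => ?_) measurableSet_Ioo
  have hr0 : 0 < r := hr.1
  simp only [smul_eq_mul]
  rw [← Real.rpow_natCast, ← Real.rpow_add hr0, Nat.cast_pred finrank_pos]
  congr 1; ring

/-- Within unit distance of `x`, bound `f` by `B`; farther away, the kernel is at most `1` because
`p ≤ d`. -/
lemma lintegral_riesz_mul_le [Nontrivial E] {p : ℝ} (hpd : p ≤ finrank ℝ E) {f : E → ℝ} {B : ℝ}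
    (hf : ∀ y, |f y| ≤ B) (x : E) :
    ∫⁻ y, ENNReal.ofReal (‖x - y‖ ^ (p - finrank ℝ E)) * ‖f y‖ₑ ≤
      ENNReal.ofReal B * (∫⁻ y in Metric.ball (0 : E) 1,
        ENNReal.ofReal (‖y‖ ^ (p - finrank ℝ E))) + ∫⁻ y, ‖f y‖ₑ := by
  set k : E → ENNReal := (Metric.ball (0 : E) 1).indicator
    (fun y => ENNReal.ofReal (‖y‖ ^ (p - finrank ℝ E))) with hk
  have hkm : Measurable k := Measurable.indicator (by fun_prop) measurableSet_ball
  have h1 : ∀ y, ENNReal.ofReal (‖x - y‖ ^ (p - finrank ℝ E)) * ‖f y‖ₑ ≤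
      ENNReal.ofReal B * k (x - y) + ‖f y‖ₑ := fun y => by
    have hB : ‖f y‖ₑ ≤ ENNReal.ofReal B := by
      rw [Real.enorm_eq_ofReal_abs]; exact ENNReal.ofReal_le_ofReal (hf y)
    by_cases h : x - y ∈ Metric.ball (0 : E) 1
    · rw [hk, indicator_of_mem h, mul_comm]
      exact le_add_right (by gcongr)
    · rw [hk, indicator_of_notMem h, mul_zero, zero_add]
      have : ‖x - y‖ ^ (p - finrank ℝ E) ≤ 1 :=
        Real.rpow_le_one_of_one_le_of_nonpos (by simpa using h) (by linarith)
      calc _ ≤ ENNReal.ofReal 1 * ‖f y‖ₑ := by gcongr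
        _ = ‖f y‖ₑ := by simp
  calc _ ≤ ∫⁻ y, (ENNReal.ofReal B * k (x - y) + ‖f y‖ₑ) := lintegral_mono h1
    _ = _ := by
      rw [lintegral_add_left (by fun_prop), lintegral_const_mul _ (by fun_prop),
        lintegral_sub_left_eq_self, hk, lintegral_indicator measurableSet_ball]

lemma exists_lintegral_riesz_mul_le [Nontrivial E] {p : ℝ} (hp : 0 < p) (hpd : p ≤ finrank ℝ E)
    {f : E → ℝ} {B : ℝ} (hf : ∀ y, |f y| ≤ B) (hfi : Integrable f) :
    ∃ K, K < ⊤ ∧ ∀ x, ∫⁻ y, ENNReal.ofReal (‖x - y‖ ^ (p - finrank ℝ E)) * ‖f y‖ₑ ≤ K :=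
  ⟨_, ENNReal.add_lt_top.2 ⟨ENNReal.mul_lt_top ENNReal.ofReal_lt_top
    (integrableOn_ball_norm_rpow hp).lintegral_lt_top, hfi.2⟩, lintegral_riesz_mul_le hpd hf⟩

lemma integrable_riesz_mul [Nontrivial E] {p : ℝ} (hp : 0 < p) (hpd : p ≤ finrank ℝ E)
    {f : E → ℝ} {B : ℝ} (hf : ∀ y, |f y| ≤ B) (hfi : Integrable f) (x : E) :
    Integrable (fun y => ‖x - y‖ ^ (p - finrank ℝ E) * f y) := by
  obtain ⟨K, hK, h⟩ := exists_lintegral_riesz_mul_le hp hpd hf hfi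
  refine ⟨(by fun_prop : Measurable
    (fun y => ‖x - y‖ ^ (p - finrank ℝ E))).aestronglyMeasurable.mul hfi.1, ?_⟩
  refine lt_of_eq_of_lt (lintegral_congr fun y => ?_) ((h x).trans_lt hK)
  rw [enorm_mul, Real.enorm_eq_ofReal (by positivity)]

lemma integrable_min_one_sq_div_norm_rpow [Nontrivial E] {s : ℝ} (hs0 : 0 < s) (hs1 : s < 1) :
    Integrable (fun y : E => min 1 (‖y‖ ^ 2) / ‖y‖ ^ ((finrank ℝ E : ℝ) + 2 * s)) := by
  rw [integrable_fun_norm_addHaar volume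
    (f := fun r : ℝ => min 1 (r ^ 2) / r ^ ((finrank ℝ E : ℝ) + 2 * s)),
    ← Ioc_union_Ioi_eq_Ioi zero_le_one, integrableOn_union]
  have hpow : ∀ r : ℝ, 0 < r → r ^ (finrank ℝ E - 1) / r ^ ((finrank ℝ E : ℝ) + 2 * s) =
      r ^ (-1 - 2 * s) := fun r hr => by
    rw [← Real.rpow_natCast, ← Real.rpow_sub hr, Nat.cast_pred finrank_pos]
    congr 1; ring
  constructor
  · have h : IntegrableOn (fun r : ℝ => r ^ (1 - 2 * s)) (Ioc 0 1) :=
      (intervalIntegral.intervalIntegrable_rpow' (by linarith)).1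
    refine h.congr_fun (fun r hr => ?_) measurableSet_Ioc
    have hr0 : 0 < r := hr.1
    simp only [smul_eq_mul]
    rw [min_eq_right (pow_le_one₀ hr0.le hr.2), mul_div_left_comm, hpow r hr0,
      ← Real.rpow_natCast, ← Real.rpow_add hr0]
    congr 1; push_cast; ring
  · have h : IntegrableOn (fun r : ℝ => r ^ (-1 - 2 * s)) (Ioi 1) :=
      integrableOn_Ioi_rpow_of_lt (by linarith) one_pos
    refine h.congr_fun (fun r hr => ?_) measurableSet_Ioi
    have hr1 : 1 < r := hr
    simp only [smul_eq_mul]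
    rw [min_eq_left (one_le_pow₀ hr1.le), mul_one_div, hpow r (by linarith)]

/-- The symmetric second difference. -/
def secondDiff (ψ : E → ℝ) (x y : E) : ℝ := 2 * ψ x - ψ (x + y) - ψ (x - y)

/-- The quadratic bound comes from the Lipschitz continuity of the derivative: the first-order
Taylor terms at `y` and `-y` cancel. -/
lemma exists_abs_secondDiff_le {ψ : E → ℝ} (hψ : ContDiff ℝ ∞ ψ) (hc : HasCompactSupport ψ) :
    ∃ C, 0 ≤ C ∧ ∀ x y, |secondDiff ψ x y| ≤ C * min 1 (‖y‖ ^ 2) := by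
  obtain ⟨B, hB⟩ := hc.exists_bound_of_continuous hψ.continuous
  have h1 : ContDiff ℝ 1 (fderiv ℝ ψ) := hψ.fderiv_right (by norm_cast)
  obtain ⟨L, hL⟩ := h1.lipschitzWith_of_hasCompactSupport (hc.fderiv (𝕜 := ℝ)) one_ne_zero
  have hT : ∀ x y, |ψ (x + y) - ψ x - fderiv ℝ ψ x y| ≤ L * ‖y‖ ^ 2 := fun x y => by
    have h := (convex_closedBall x ‖y‖).norm_image_sub_le_of_norm_hasFDerivWithin_le'
      (f := ψ) (f' := fderiv ℝ ψ) (C := L * ‖y‖) (φ := fderiv ℝ ψ x) (x := x) (y := x + y)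
      (fun z _ => ((hψ.differentiable (by simp)) z).hasFDerivAt.hasFDerivWithinAt)
      (fun z hz => by
        refine (hL.norm_sub_le z x).trans ?_
        gcongr
        simpa [dist_eq_norm] using hz) (by simp) (by simp)
    simpa [pow_two, mul_assoc] using h
  have hB0 : 0 ≤ B := (norm_nonneg _).trans (hB 0)
  refine ⟨4 * B + 2 * L, by positivity, fun x y => ?_⟩
  have hL0 : (0 : ℝ) ≤ L := L.2
  rcases min_choice 1 (‖y‖ ^ 2) with h | h
  · rw [h, secondDiff]
    have := abs_le.1 (hB x)
    have := abs_le.1 (hB (x + y))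
    have := abs_le.1 (hB (x - y))
    rw [abs_le]; constructor <;> linarith
  · rw [h, secondDiff]
    have h2 := abs_le.1 (hT x y)
    have h3 := hT x (-y)
    rw [norm_neg, map_neg, ← sub_eq_add_neg] at h3
    have h3 := abs_le.1 h3
    have : 0 ≤ B * ‖y‖ ^ 2 := by positivity
    rw [abs_le]; constructor <;> nlinarith

/-- The version integrated in `x`, needed for Fubini. For `‖y‖ ≤ 1` the second difference lives in a
fixed ball, so the pointwise bound is multiplied by a volume; for `‖y‖ ≥ 1` it is at most four times
the `L¹` norm of `ψ`. -/
lemma exists_lintegral_secondDiff_le {ψ : E → ℝ} (hψ : ContDiff ℝ ∞ ψ)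
    (hc : HasCompactSupport ψ) :
    ∃ C : ℝ, 0 ≤ C ∧ ∀ y, ∫⁻ x, ‖secondDiff ψ x y‖ₑ ≤ ENNReal.ofReal (C * min 1 (‖y‖ ^ 2)) := by
  obtain ⟨C, hC, h⟩ := exists_abs_secondDiff_le hψ hc
  obtain ⟨R, hR⟩ := hc.isCompact.isBounded.subset_ball 0
  have hψi : Integrable ψ := hψ.continuous.integrable_of_hasCompactSupport hc
  set V := (volume (Metric.ball (0 : E) (R + 1))).toReal
  have hV : ENNReal.ofReal V = volume (Metric.ball (0 : E) (R + 1)) :=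
    ENNReal.ofReal_toReal measure_ball_lt_top.ne
  set I := ∫ x, ‖ψ x‖
  have hI : ENNReal.ofReal I = ∫⁻ x, ‖ψ x‖ₑ := ofReal_integral_norm_eq_lintegral_enorm hψi
  have hI0 : 0 ≤ I := integral_nonneg fun _ => norm_nonneg _
  have hV0 : 0 ≤ V := ENNReal.toReal_nonneg
  refine ⟨C * V + 4 * I, by positivity, fun y => ?_⟩
  rcases le_total (‖y‖) 1 with hy | hy
  · have hmin : min 1 (‖y‖ ^ 2) = ‖y‖ ^ 2 := min_eq_right (pow_le_one₀ (norm_nonneg _) hy)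
    have h0 : ∀ x, ‖secondDiff ψ x y‖ₑ ≤ (Metric.ball (0 : E) (R + 1)).indicator
        (fun _ => ENNReal.ofReal (C * min 1 (‖y‖ ^ 2))) x := fun x => by
      by_cases hx : x ∈ Metric.ball (0 : E) (R + 1)
      · rw [indicator_of_mem hx, Real.enorm_eq_ofReal_abs]
        exact ENNReal.ofReal_le_ofReal (h x y)
      · have hx' : R + 1 ≤ ‖x‖ := by simpa using hx
        have hz : ∀ z, R ≤ ‖z‖ → ψ z = 0 := fun z hz => by
          by_contra hne
          have := hR (subset_tsupport _ (Function.mem_support.2 hne))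
          rw [mem_ball_zero_iff] at this
          linarith
        have h3 := norm_sub_norm_le x (-y)
        have h4 := norm_sub_norm_le x y
        rw [sub_neg_eq_add, norm_neg] at h3
        rw [indicator_of_notMem hx, secondDiff, hz x (by linarith), hz (x + y) (by linarith),
          hz (x - y) (by linarith)]
        simp
    calc _ ≤ _ := lintegral_mono h0
      _ = ENNReal.ofReal (C * min 1 (‖y‖ ^ 2)) * ENNReal.ofReal V := by
        rw [lintegral_indicator measurableSet_ball, hV]; simp
      _ ≤ _ := by
        rw [← ENNReal.ofReal_mul (by positivity)]
        refine ENNReal.ofReal_le_ofReal ?_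
        have : 0 ≤ I * min 1 (‖y‖ ^ 2) := by positivity
        nlinarith
  · have hmin : min 1 (‖y‖ ^ 2) = 1 := min_eq_left (one_le_pow₀ hy)
    have h0 : ∀ x, ‖secondDiff ψ x y‖ₑ ≤ 2 * ‖ψ x‖ₑ + ‖ψ (x + y)‖ₑ + ‖ψ (x - y)‖ₑ := fun x => by
      refine (enorm_sub_le).trans ?_
      gcongr
      refine (enorm_sub_le).trans ?_
      gcongr
      rw [enorm_mul]
      simp [enorm]
    calc _ ≤ _ := lintegral_mono h0
      _ = 4 * ENNReal.ofReal I := by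
        have hm := hψ.continuous.measurable
        rw [lintegral_add_left (by fun_prop), lintegral_add_left (by fun_prop),
          lintegral_const_mul _ (by fun_prop), lintegral_add_right_eq_self (fun x => ‖ψ x‖ₑ),
          lintegral_sub_right_eq_self (fun x => ‖ψ x‖ₑ), hI]
        ring
      _ = ENNReal.ofReal (4 * I) := by
        rw [ENNReal.ofReal_mul (by norm_num)]; norm_num
      _ ≤ _ := by
        refine ENNReal.ofReal_le_ofReal ?_
        rw [hmin, mul_one]
        have : 0 ≤ C * V := by positivity
        linarith

variable {s : ℝ} {ψ : E → ℝ}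

lemma integrable_secondDiff_prod [Nontrivial E] (hs0 : 0 < s) (hs1 : s < 1)
    (hψ : ContDiff ℝ ∞ ψ) (hc : HasCompactSupport ψ) :
    Integrable (fun p : E × E => secondDiff ψ p.1 p.2 / ‖p.2‖ ^ ((finrank ℝ E : ℝ) + 2 * s))
      (volume.prod volume) := by
  obtain ⟨C, hC, h⟩ := exists_lintegral_secondDiff_le hψ hc
  have hm := hψ.continuous.measurable
  have hmeas : Measurable (fun p : E × E => secondDiff ψ p.1 p.2 /
      ‖p.2‖ ^ ((finrank ℝ E : ℝ) + 2 * s)) := by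
    unfold secondDiff; fun_prop
  refine ⟨hmeas.aestronglyMeasurable, ?_⟩
  rw [HasFiniteIntegral, lintegral_prod_symm' _ hmeas.enorm]
  have hi := ((integrable_min_one_sq_div_norm_rpow (E := E) hs0 hs1).const_mul C).lintegral_lt_top
  refine (lintegral_mono fun y => ?_).trans_lt hi
  have h1 : ∀ x, ‖secondDiff ψ x y / ‖y‖ ^ ((finrank ℝ E : ℝ) + 2 * s)‖ₑ =
      ‖secondDiff ψ x y‖ₑ * ENNReal.ofReal (‖y‖ ^ ((finrank ℝ E : ℝ) + 2 * s))⁻¹ := fun x => by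
    rw [div_eq_mul_inv, enorm_mul, Real.enorm_eq_ofReal
      (by positivity : 0 ≤ (‖y‖ ^ ((finrank ℝ E : ℝ) + 2 * s))⁻¹)]
  have hm2 : Measurable fun x => ‖secondDiff ψ x y‖ₑ := by unfold secondDiff; fun_prop
  simp only [h1]
  rw [lintegral_mul_const _ hm2]
  calc _ ≤ ENNReal.ofReal (C * min 1 (‖y‖ ^ 2)) *
        ENNReal.ofReal (‖y‖ ^ ((finrank ℝ E : ℝ) + 2 * s))⁻¹ := by gcongr; exact h y
    _ = _ := by rw [← ENNReal.ofReal_mul (by positivity)]; congr 1; ring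

/-- The fractional Laplacian without its normalisation constant. -/
noncomputable def fracLap (s : ℝ) (ψ : E → ℝ) (x : E) : ℝ :=
  ∫ y : E, secondDiff ψ x y / ‖y‖ ^ ((finrank ℝ E : ℝ) + 2 * s)

lemma integrable_fracLap [Nontrivial E] (hs0 : 0 < s) (hs1 : s < 1)
    (hψ : ContDiff ℝ ∞ ψ) (hc : HasCompactSupport ψ) : Integrable (fracLap s ψ) :=
  (integrable_secondDiff_prod hs0 hs1 hψ hc).integral_prod_left

lemma exists_abs_fracLap_le [Nontrivial E] (hs0 : 0 < s) (hs1 : s < 1)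
    (hψ : ContDiff ℝ ∞ ψ) (hc : HasCompactSupport ψ) : ∃ B, ∀ x, |fracLap s ψ x| ≤ B := by
  obtain ⟨C, hC, h⟩ := exists_abs_secondDiff_le hψ hc
  refine ⟨_, fun x => (Real.norm_eq_abs _).symm.trans_le <| norm_integral_le_of_norm_le
    ((integrable_min_one_sq_div_norm_rpow (E := E) hs0 hs1).const_mul C)
    (Filter.Eventually.of_forall fun y => ?_)⟩
  rw [norm_div, Real.norm_of_nonneg (by positivity : 0 ≤ ‖y‖ ^ ((finrank ℝ E : ℝ) + 2 * s)),
    ← mul_div_assoc]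
  gcongr
  exact h x y
end

/-! ### The Fourier symbol of the fractional Laplacian -/

section
variable {E : Type*} [NormedAddCommGroup E] [InnerProductSpace ℝ E] [FiniteDimensional ℝ E]
  [MeasurableSpace E] [BorelSpace E]

open Module
open scoped FourierTransform

variable {s : ℝ} {ψ : E → ℝ}

/-- The Fourier symbol of `fracLap`. -/
noncomputable def fracSymbol (s : ℝ) (ξ : E) : ℝ :=
  ∫ y : E, (2 - 2 * Real.cos (2 * Real.pi * inner ℝ y ξ)) / ‖y‖ ^ ((finrank ℝ E : ℝ) + 2 * s)

lemma two_sub_two_mul_cos_nonneg (t : ℝ) : 0 ≤ 2 - 2 * Real.cos t := by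
  linarith [Real.cos_le_one t]

lemma integrable_two_sub_two_mul_cos_div [Nontrivial E] (hs0 : 0 < s) (hs1 : s < 1) (ξ : E) :
    Integrable (fun y : E => (2 - 2 * Real.cos (2 * Real.pi * inner ℝ y ξ)) /
      ‖y‖ ^ ((finrank ℝ E : ℝ) + 2 * s)) := by
  refine ((integrable_min_one_sq_div_norm_rpow (E := E) hs0 hs1).const_mul
    (4 + 4 * Real.pi ^ 2 * ‖ξ‖ ^ 2)).mono' (by fun_prop : Measurable _).aestronglyMeasurable
    (Filter.Eventually.of_forall fun y => ?_)
  rw [Real.norm_of_nonneg (div_nonneg (two_sub_two_mul_cos_nonneg _) (by positivity)),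
    ← mul_div_assoc]
  gcongr
  set t := 2 * Real.pi * inner ℝ y ξ with ht
  have hc := Real.neg_one_le_cos t
  have hc2 := Real.one_sub_sq_div_two_le_cos (x := t)
  have hb : 0 ≤ 4 * Real.pi ^ 2 * ‖ξ‖ ^ 2 := by positivity
  rcases min_choice 1 (‖y‖ ^ 2) with h | h
  · rw [h]; linarith
  · rw [h]
    have h1 : (inner ℝ y ξ) ^ 2 ≤ (‖y‖ * ‖ξ‖) ^ 2 := by
      rw [← sq_abs]
      gcongr
      exact abs_real_inner_le_norm y ξ
    have h2 : t ^ 2 ≤ 4 * Real.pi ^ 2 * ‖ξ‖ ^ 2 * ‖y‖ ^ 2 := by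
      have := mul_le_mul_of_nonneg_left h1 (by positivity : 0 ≤ 4 * Real.pi ^ 2)
      calc t ^ 2 = 4 * Real.pi ^ 2 * (inner ℝ y ξ) ^ 2 := by rw [ht]; ring
        _ ≤ _ := this
        _ = _ := by ring
    nlinarith [sq_nonneg ‖y‖]

/-- Translations by `±y` multiply the Fourier transform by conjugate characters, so the second
difference contributes the factor `2 - 2 cos(2π⟪y, ξ⟫)`; joint integrability permits integrating in
`x` first. -/
lemma fourier_fracLap [Nontrivial E] (hs0 : 0 < s) (hs1 : s < 1)
    (hψ : ContDiff ℝ ∞ ψ) (hc : HasCompactSupport ψ) (ξ : E) :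
    𝓕 (fun x => (fracLap s ψ x : ℂ)) ξ = fracSymbol s ξ * 𝓕 (fun x => (ψ x : ℂ)) ξ := by
  have hψi : Integrable (fun x => (ψ x : ℂ)) :=
    (hψ.continuous.integrable_of_hasCompactSupport hc).ofReal
  set e : E → ℂ := fun x => Complex.exp (↑(-2 * Real.pi * inner ℝ x ξ) * Complex.I) with he
  have hen : ∀ x, ‖e x‖ = 1 := fun x => Complex.norm_exp_ofReal_mul_I _
  have hec : Continuous e := by fun_prop
  have hei : Integrable (fun x => e x * (ψ x : ℂ)) :=
    hψi.bdd_mul hec.aestronglyMeasurable (Filter.Eventually.of_forall fun x => (hen x).le)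
  have htr : ∀ y, e y * (∫ x, e x * (ψ (x + y) : ℂ)) = ∫ x, e x * (ψ x : ℂ) := fun y => by
    rw [← integral_add_right_eq_self (fun x => e x * (ψ x : ℂ)) y, ← integral_const_mul]
    refine integral_congr_ae (Filter.Eventually.of_forall fun x => ?_)
    simp only [he, inner_add_left, mul_add, Complex.ofReal_add, add_mul, Complex.exp_add]
    ring
  have heneg : ∀ y, e y * e (-y) = 1 := fun y => by
    simp only [he]
    rw [← Complex.exp_add, inner_neg_left]
    simp
  have htr' : ∀ y, (∫ x, e x * (ψ (x + y) : ℂ)) = e (-y) * ∫ x, e x * (ψ x : ℂ) := fun y => by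
    rw [← htr y, ← mul_assoc, mul_comm (e (-y)), heneg, one_mul]
  have hint : ∀ y, Integrable (fun x => e x * (ψ (x + y) : ℂ)) := fun y =>
    (hψi.comp_add_right y).bdd_mul hec.aestronglyMeasurable
      (Filter.Eventually.of_forall fun x => (hen x).le)
  have hcos : ∀ y, e (-y) + e y = 2 * Real.cos (2 * Real.pi * inner ℝ y ξ) := fun y => by
    have h1 : e y = Complex.exp (-(↑(2 * Real.pi * inner ℝ y ξ) : ℂ) * Complex.I) := by
      simp only [he]; congr 1; push_cast; ring
    have h2 : e (-y) = Complex.exp ((↑(2 * Real.pi * inner ℝ y ξ) : ℂ) * Complex.I) := by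
      simp only [he]; congr 1; rw [inner_neg_left]; push_cast; ring
    rw [h1, h2, Complex.ofReal_cos, Complex.two_cos]
  have hinner : ∀ y, ∫ x, e x * ((secondDiff ψ x y / ‖y‖ ^ ((finrank ℝ E : ℝ) + 2 * s) : ℝ) : ℂ) =
      (((2 - 2 * Real.cos (2 * Real.pi * inner ℝ y ξ)) /
        ‖y‖ ^ ((finrank ℝ E : ℝ) + 2 * s) : ℝ) : ℂ) * ∫ x, e x * (ψ x : ℂ) := fun y => by
    have h1 : ∀ x, e x * ((secondDiff ψ x y / ‖y‖ ^ ((finrank ℝ E : ℝ) + 2 * s) : ℝ) : ℂ) =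
        ((‖y‖ ^ ((finrank ℝ E : ℝ) + 2 * s) : ℝ) : ℂ)⁻¹ * (2 * (e x * (ψ x : ℂ)) -
          e x * (ψ (x + y) : ℂ) - e x * (ψ (x + -y) : ℂ)) := fun x => by
      rw [secondDiff, ← sub_eq_add_neg]; push_cast; ring
    have h2 : Integrable (fun x => 2 * (e x * (ψ x : ℂ)) - e x * (ψ (x + y) : ℂ)) :=
      (hei.const_mul 2).sub (hint y)
    simp only [h1]
    rw [integral_const_mul, integral_sub h2 (hint (-y)),
      integral_sub (hei.const_mul 2) (hint y), integral_const_mul, htr', htr', neg_neg]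
    push_cast
    have := hcos y
    push_cast at this
    linear_combination (-((‖y‖ ^ ((finrank ℝ E : ℝ) + 2 * s) : ℝ) : ℂ)⁻¹ *
      ∫ x, e x * (ψ x : ℂ)) * this
  have hF := (integrable_secondDiff_prod hs0 hs1 hψ hc).ofReal (𝕜 := ℂ)
  have hF' : Integrable (fun p : E × E => e p.1 *
      ((secondDiff ψ p.1 p.2 / ‖p.2‖ ^ ((finrank ℝ E : ℝ) + 2 * s) : ℝ) : ℂ))
      (volume.prod volume) :=
    hF.bdd_mul (hec.comp continuous_fst).aestronglyMeasurable
      (Filter.Eventually.of_forall fun p => (hen p.1).le)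
  rw [Real.fourier_eq', Real.fourier_eq']
  simp only [smul_eq_mul]
  calc ∫ x, e x * (fracLap s ψ x : ℂ)
      = ∫ x, ∫ y, e x * ((secondDiff ψ x y / ‖y‖ ^ ((finrank ℝ E : ℝ) + 2 * s) : ℝ) : ℂ) := by
        congr 1 with x
        rw [integral_const_mul, fracLap, integral_complex_ofReal]
    _ = ∫ y, ∫ x, e x * ((secondDiff ψ x y / ‖y‖ ^ ((finrank ℝ E : ℝ) + 2 * s) : ℝ) : ℂ) :=
        integral_integral_swap hF'
    _ = fracSymbol s ξ * ∫ x, e x * (ψ x : ℂ) := by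
        simp only [hinner]
        rw [integral_mul_const, fracSymbol, integral_complex_ofReal]

lemma fracSymbol_smul [Nontrivial E] {c : ℝ} (hc : 0 < c) (ξ : E) :
    fracSymbol s (c • ξ) = c ^ (2 * s) * fracSymbol s ξ := by
  have h := Measure.integral_comp_smul volume
    (fun y : E => (2 - 2 * Real.cos (2 * Real.pi * inner ℝ y ξ)) /
      ‖y‖ ^ ((finrank ℝ E : ℝ) + 2 * s)) c
  rw [smul_eq_mul, abs_of_pos (by positivity)] at h
  have h2 : fracSymbol s ξ = c ^ finrank ℝ E *
      ∫ y : E, (2 - 2 * Real.cos (2 * Real.pi * inner ℝ (c • y) ξ)) /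
      ‖c • y‖ ^ ((finrank ℝ E : ℝ) + 2 * s) := by
    rw [h, ← mul_assoc, mul_inv_cancel₀ (by positivity), one_mul, fracSymbol]
  rw [h2, ← mul_assoc, ← integral_const_mul, fracSymbol]
  congr 1 with y
  rw [inner_smul_left, inner_smul_right, norm_smul, Real.norm_of_nonneg hc.le,
    Real.mul_rpow hc.le (norm_nonneg _), Real.rpow_add hc, Real.rpow_natCast]
  simp only [RCLike.conj_to_real]
  have := (Real.rpow_pos_of_pos hc (2 * s)).ne'
  have := (pow_pos hc (finrank ℝ E)).ne'
  field_simp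

lemma fracSymbol_isometry (A : E ≃ₗᵢ[ℝ] E) (ξ : E) : fracSymbol s (A ξ) = fracSymbol s ξ := by
  rw [fracSymbol, ← A.measurePreserving.integral_comp A.toHomeomorph.measurableEmbedding]
  simp [fracSymbol]

lemma fracSymbol_pos [Nontrivial E] (hs0 : 0 < s) (hs1 : s < 1) {ξ : E} (hξ : ξ ≠ 0) :
    0 < fracSymbol s ξ := by
  have hnn : ∀ y : E, 0 ≤ (2 - 2 * Real.cos (2 * Real.pi * inner ℝ y ξ)) /
      ‖y‖ ^ ((finrank ℝ E : ℝ) + 2 * s) := fun y =>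
    div_nonneg (two_sub_two_mul_cos_nonneg _) (by positivity)
  rw [fracSymbol, integral_pos_iff_support_of_nonneg hnn
    (integrable_two_sub_two_mul_cos_div hs0 hs1 ξ)]
  have hcont : Continuous fun y : E => Real.cos (2 * Real.pi * inner ℝ y ξ) := by fun_prop
  have hopen : IsOpen {y : E | Real.cos (2 * Real.pi * inner ℝ y ξ) < 1} :=
    isOpen_lt hcont continuous_const
  have hne : {y : E | Real.cos (2 * Real.pi * inner ℝ y ξ) < 1}.Nonempty := by
    -- This multiple of `ξ` makes the phase `π`, where the cosine is `-1`.
    refine ⟨(2 * ‖ξ‖ ^ 2)⁻¹ • ξ, ?_⟩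
    have h1 : 2 * Real.pi * inner ℝ ((2 * ‖ξ‖ ^ 2)⁻¹ • ξ) ξ = Real.pi := by
      rw [inner_smul_left, real_inner_self_eq_norm_sq, RCLike.conj_to_real]
      have := norm_ne_zero_iff.2 hξ
      field_simp
    simp only [mem_ofPred_eq]
    rw [h1, Real.cos_pi]; norm_num
  refine (hopen.measure_pos volume hne).trans_le (measure_mono fun y hy => ?_)
  have hy' : Real.cos (2 * Real.pi * inner ℝ y ξ) < 1 := hy
  have hy0 : 0 < ‖y‖ := by
    rw [norm_pos_iff]
    rintro rfl
    simp at hy'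
  rw [Function.mem_support]
  exact (div_pos (by linarith) (by positivity)).ne'

/-- The symbol is homogeneous of degree `2s` and invariant under isometries. A reflection carries a
fixed unit vector to `ξ / ‖ξ‖`, so one positive value determines the whole symbol. -/
lemma exists_fracSymbol_eq [Nontrivial E] (hs0 : 0 < s) (hs1 : s < 1) :
    ∃ W : ℝ, 0 < W ∧ ∀ ξ : E, ξ ≠ 0 → fracSymbol s ξ = W * ‖ξ‖ ^ (2 * s) := by
  obtain ⟨e, he⟩ := exists_norm_eq E zero_le_one
  refine ⟨fracSymbol s e, fracSymbol_pos hs0 hs1 (norm_ne_zero_iff.1 (by simp [he])),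
    fun ξ hξ => ?_⟩
  have hn : 0 < ‖ξ‖ := norm_pos_iff.2 hξ
  have h1 : ‖e‖ = ‖‖ξ‖⁻¹ • ξ‖ := by
    rw [he, norm_smul, norm_inv, norm_norm, inv_mul_cancel₀ hn.ne']
  have h2 := fracSymbol_isometry (s := s) ((ℝ ∙ (e - ‖ξ‖⁻¹ • ξ))ᗮ.reflection) e
  rw [Submodule.reflection_sub h1] at h2
  rw [← h2, mul_comm, ← fracSymbol_smul hn, smul_smul, mul_inv_cancel₀ hn.ne', one_smul]
end

/-! ### The Riesz potential as inverse of the fractional Laplacian -/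

/-- The change `b ↦ 1/b` turns this into a Gamma integral with parameter `d/2 - s`. It writes the
Riesz kernel as a superposition of Gaussians, which avoids Fourier transforming a kernel that is not
integrable. -/
lemma integral_rpow_mul_gaussian_inv {s d r : ℝ} (hsd : 2 * s < d) (hr : 0 < r) :
    ∫ b in Ioi (0 : ℝ), b ^ (s - 1) * ((Real.pi / b) ^ (d / 2) *
      Real.exp (-Real.pi ^ 2 * r ^ 2 / b)) =
    Real.pi ^ (d / 2) * Real.Gamma (d / 2 - s) * (Real.pi ^ 2) ^ (s - d / 2) *
      r ^ (2 * s - d) := by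
  have hπ := Real.pi_pos
  rw [← integral_comp_rpow_Ioi _ (by norm_num : (-1 : ℝ) ≠ 0)]
  have h1 : ∀ x ∈ Ioi (0 : ℝ), (|(-1 : ℝ)| * x ^ ((-1 : ℝ) - 1)) • ((x ^ (-1 : ℝ)) ^ (s - 1) *
      ((Real.pi / x ^ (-1 : ℝ)) ^ (d / 2) * Real.exp (-Real.pi ^ 2 * r ^ 2 / x ^ (-1 : ℝ)))) =
      Real.pi ^ (d / 2) * (x ^ ((d / 2 - s) - 1) * Real.exp (-(Real.pi ^ 2 * r ^ 2 * x))) :=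
    fun x hx => by
      have hx0 : 0 < x := hx
      have e1 : Real.pi / x ^ (-1 : ℝ) = Real.pi * x := by rw [Real.rpow_neg_one]; field_simp
      have e2 : -Real.pi ^ 2 * r ^ 2 / x ^ (-1 : ℝ) = -(Real.pi ^ 2 * r ^ 2 * x) := by
        rw [Real.rpow_neg_one]; field_simp
      have e3 : x ^ ((d / 2 - s) - 1) = x ^ ((-1 : ℝ) - 1) * (x ^ (-1 : ℝ)) ^ (s - 1) *
          x ^ (d / 2) := by
        rw [← Real.rpow_mul hx0.le, ← Real.rpow_add hx0, ← Real.rpow_add hx0]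
        congr 1; ring
      rw [e1, e2, e3, Real.mul_rpow hπ.le hx0.le, smul_eq_mul]
      simp only [abs_neg, abs_one]
      ring
  rw [setIntegral_congr_fun measurableSet_Ioi h1, integral_const_mul,
    Real.integral_rpow_mul_exp_neg_mul_Ioi (by linarith) (by positivity)]
  have h2 : (1 / (Real.pi ^ 2 * r ^ 2)) ^ (d / 2 - s) =
      (Real.pi ^ 2) ^ (s - d / 2) * r ^ (2 * s - d) := by
    rw [one_div, Real.inv_rpow (by positivity), ← Real.rpow_neg (by positivity),
      Real.mul_rpow (by positivity) (by positivity), ← Real.rpow_natCast r 2,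
      ← Real.rpow_mul hr.le]
    congr 2
    · ring
    · push_cast; ring
  rw [h2]; ring

section
variable {E : Type*} [NormedAddCommGroup E] [InnerProductSpace ℝ E] [FiniteDimensional ℝ E]
  [MeasurableSpace E] [BorelSpace E]

open Module
open scoped FourierTransform

variable {s : ℝ} {ψ : E → ℝ}

/-- The Fourier transform is moved from a modulated Gaussian to the fractional Laplacian, where it
becomes multiplication by the symbol. -/
lemma integral_gaussian_mul_fracLap [Nontrivial E] (hs0 : 0 < s) (hs1 : s < 1)
    (hψ : ContDiff ℝ ∞ ψ) (hc : HasCompactSupport ψ) (x : E) {b : ℝ} (hb : 0 < b) :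
    ∫ y, (((Real.pi / b) ^ ((finrank ℝ E : ℝ) / 2) * Real.exp (-Real.pi ^ 2 * ‖x - y‖ ^ 2 / b) *
      fracLap s ψ y : ℝ) : ℂ) =
    ∫ ξ : E, Complex.exp (-b * ‖ξ‖ ^ 2 + 2 * Real.pi * Complex.I * inner ℝ x ξ) *
      (fracSymbol s ξ * 𝓕 (fun x => (ψ x : ℂ)) ξ) := by
  have hb' : 0 < (b : ℂ).re := by simpa
  have h := VectorFourier.integral_fourierIntegral_smul_eq_flip (L := innerₗ E)
    (μ := volume) (ν := volume) (f := fun v : E => Complex.exp (-b * ‖v‖ ^ 2 +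
      2 * Real.pi * Complex.I * inner ℝ x v)) (g := fun y => (fracLap s ψ y : ℂ))
    Real.continuous_fourierChar (by exact continuous_inner)
    (GaussianFourier.integrable_cexp_neg_mul_sq_norm_add hb' (2 * Real.pi * Complex.I) x)
    (integrable_fracLap hs0 hs1 hψ hc).ofReal
  rw [flip_innerₗ] at h
  change ∫ y, 𝓕 (fun v : E => Complex.exp (-b * ‖v‖ ^ 2 +
      2 * Real.pi * Complex.I * inner ℝ x v)) y • (fracLap s ψ y : ℂ) =
    ∫ ξ, _ • 𝓕 (fun y => (fracLap s ψ y : ℂ)) ξ at h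
  simp only [fourier_gaussian_innerProductSpace' hb',
    fourier_fracLap hs0 hs1 hψ hc, smul_eq_mul] at h
  rw [← h]
  congr 1 with y
  push_cast
  rw [Complex.ofReal_cpow (by positivity)]
  push_cast
  rfl

lemma integral_exp_mul_fourier [Nontrivial E] (hψ : ContDiff ℝ ∞ ψ) (hc : HasCompactSupport ψ)
    (x : E) :
    Integrable (𝓕 (fun x => (ψ x : ℂ))) ∧
    ∫ ξ : E, Complex.exp (2 * Real.pi * Complex.I * inner ℝ x ξ) *
      𝓕 (fun x => (ψ x : ℂ)) ξ = ψ x := by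
  have hsm : ContDiff ℝ ∞ (fun x => (ψ x : ℂ)) := Complex.ofRealCLM.contDiff.comp hψ
  have hcs : HasCompactSupport (fun x => (ψ x : ℂ)) := hc.comp_left Complex.ofReal_zero
  have hi : Integrable (𝓕 (fun x => (ψ x : ℂ))) :=
    (𝓕 (hcs.toSchwartzMap hsm)).integrable
  refine ⟨hi, ?_⟩
  have h := hsm.continuous.fourierInv_fourier_eq
    (hsm.continuous.integrable_of_hasCompactSupport hcs) hi
  have h2 := congrFun h x
  rw [Real.fourierInv_eq'] at h2
  rw [← h2]
  congr 1 with ξ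
  rw [smul_eq_mul, real_inner_comm]
  congr 2
  push_cast; ring

/-- The Riesz potential inverts the fractional Laplacian up to a constant. -/
theorem exists_integral_riesz_mul_fracLap [Nontrivial E] (hs0 : 0 < s) (hs1 : s < 1)
    (hsd : 2 * s < finrank ℝ E) :
    ∃ c : ℝ, 0 < c ∧ ∀ ψ : E → ℝ, ContDiff ℝ ∞ ψ → HasCompactSupport ψ → ∀ x,
      ∫ y, ‖x - y‖ ^ (2 * s - finrank ℝ E) * fracLap s ψ y = c * ψ x := by
  obtain ⟨W, hW, hsym⟩ := exists_fracSymbol_eq (E := E) hs0 hs1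
  set d : ℝ := (finrank ℝ E : ℝ) with hd
  have hπ := Real.pi_pos
  set A : ℝ := Real.pi ^ (d / 2) * Real.Gamma (d / 2 - s) * (Real.pi ^ 2) ^ (s - d / 2) with hA
  have hA0 : 0 < A := by
    have := Real.Gamma_pos_of_pos (show 0 < d / 2 - s by linarith)
    positivity
  have hΓ := Real.Gamma_pos_of_pos hs0
  refine ⟨Real.Gamma s * W / A, by positivity, fun ψ hψ hc x => ?_⟩
  obtain ⟨B, hB⟩ := exists_abs_fracLap_le hs0 hs1 hψ hc
  have hL := integrable_fracLap hs0 hs1 hψ hc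
  set P : ℝ → E → ℝ := fun b y => b ^ (s - 1) * ((Real.pi / b) ^ (d / 2) *
    Real.exp (-Real.pi ^ 2 * ‖x - y‖ ^ 2 / b)) with hP
  have hP0 : ∀ b ∈ Ioi (0 : ℝ), ∀ y, 0 ≤ P b y := fun b hb y => by
    have : 0 < b := hb
    positivity
  have hPint : ∀ y, y ≠ x → ∫ b in Ioi (0 : ℝ), P b y = A * ‖x - y‖ ^ (2 * s - d) := fun y hy =>
    integral_rpow_mul_gaussian_inv hsd (norm_pos_iff.2 (sub_ne_zero.2 hy.symm))
  -- The integral of a non-integrable function is `0` by convention, so the positive value just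
  -- computed forces integrability. The same argument is used for the Gamma integral below.
  have hPi : ∀ y, y ≠ x → IntegrableOn (fun b => P b y) (Ioi 0) := fun y hy => by
    by_contra h
    have h1 := hPint y hy
    rw [integral_undef h] at h1
    have : 0 < ‖x - y‖ := norm_pos_iff.2 (sub_ne_zero.2 hy.symm)
    have : 0 < A * ‖x - y‖ ^ (2 * s - d) := by positivity
    linarith
  have hae : ∀ z : E, ∀ᵐ y : E, y ≠ z := fun z => by simp [ae_iff]
  -- Integrating absolute values in `b` first leaves the Riesz kernel times `|fracLap s ψ|`, which
  -- is integrable.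
  have hF1 : Integrable (fun p : ℝ × E => ((P p.1 p.2 * fracLap s ψ p.2 : ℝ) : ℂ))
      ((volume.restrict (Ioi 0)).prod volume) := by
    apply Integrable.ofReal
    rw [integrable_prod_iff']
    · constructor
      · filter_upwards [hae x] with y hy
        exact (hPi y hy).mul_const _
      · refine ((integrable_riesz_mul (by linarith : 0 < 2 * s) hsd.le
          (f := fun y => |fracLap s ψ y|) (by simpa using hB) hL.abs x).const_mul A).congr ?_
        filter_upwards [hae x] with y hy
        rw [← mul_assoc, ← hPint y hy, ← integral_mul_const]
        refine setIntegral_congr_fun measurableSet_Ioi fun b hb => ?_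
        change P b y * |fracLap s ψ y| = ‖P b y * fracLap s ψ y‖
        rw [Real.norm_eq_abs, abs_mul, abs_of_nonneg (hP0 b hb y)]
    · exact (by fun_prop : Measurable fun p : ℝ × E => P p.1 p.2).aestronglyMeasurable.mul
        hL.1.comp_snd
  set φ := 𝓕 (fun x => (ψ x : ℂ)) with hφ
  have hφi : Integrable φ := (integral_exp_mul_fourier hψ hc x).1
  have hG : ∀ ξ : E, ξ ≠ 0 → ∫ b in Ioi (0 : ℝ), b ^ (s - 1) * Real.exp (-(‖ξ‖ ^ 2 * b)) =
      ‖ξ‖ ^ (-(2 * s)) * Real.Gamma s := fun ξ hξ => by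
    have h0 := norm_pos_iff.2 hξ
    rw [Real.integral_rpow_mul_exp_neg_mul_Ioi hs0 (by positivity), one_div,
      Real.inv_rpow (by positivity), ← Real.rpow_natCast, ← Real.rpow_mul h0.le,
      ← Real.rpow_neg h0.le]
    norm_num
  have hGi : ∀ ξ : E, ξ ≠ 0 →
      IntegrableOn (fun b => b ^ (s - 1) * Real.exp (-(‖ξ‖ ^ 2 * b))) (Ioi 0) := fun ξ hξ => by
    by_contra h
    have h1 := hG ξ hξ
    rw [integral_undef h] at h1
    have : 0 < ‖ξ‖ := norm_pos_iff.2 hξ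
    have : 0 < ‖ξ‖ ^ (-(2 * s)) * Real.Gamma s := by positivity
    linarith
  set Q : ℝ → E → ℂ := fun b ξ => ((b ^ (s - 1) * Real.exp (-(‖ξ‖ ^ 2 * b)) : ℝ) : ℂ) *
    (((W * ‖ξ‖ ^ (2 * s) : ℝ) : ℂ) * (Complex.exp (2 * Real.pi * Complex.I * inner ℝ x ξ) *
      φ ξ)) with hQ
  have hexp : ∀ ξ : E, ‖Complex.exp (2 * Real.pi * Complex.I * inner ℝ x ξ)‖ = 1 := fun ξ => by
    rw [show (2 * Real.pi * Complex.I * inner ℝ x ξ : ℂ) =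
      ((2 * Real.pi * inner ℝ x ξ : ℝ) : ℂ) * Complex.I by push_cast; ring]
    exact Complex.norm_exp_ofReal_mul_I _
  have hcancel : ∀ ξ : E, ξ ≠ 0 → ‖ξ‖ ^ (-(2 * s)) * ‖ξ‖ ^ (2 * s) = 1 := fun ξ hξ => by
    rw [← Real.rpow_add (norm_pos_iff.2 hξ), neg_add_cancel, Real.rpow_zero]
  -- On the Fourier side the integral in `b` yields `Γ(s) ‖ξ‖^{-2s}`, which cancels the symbol and
  -- leaves a multiple of the integrable function `‖φ‖`.
  have hF2 : Integrable (fun p : ℝ × E => Q p.1 p.2) ((volume.restrict (Ioi 0)).prod volume) := by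
    rw [integrable_prod_iff']
    · constructor
      · filter_upwards [hae 0] with ξ hξ
        exact (Integrable.ofReal (hGi ξ hξ)).mul_const _
      · refine (hφi.norm.const_mul (Real.Gamma s * W)).congr ?_
        filter_upwards [hae 0] with ξ hξ
        have h1 : ∀ b ∈ Ioi (0 : ℝ), ‖Q b ξ‖ = (b ^ (s - 1) * Real.exp (-(‖ξ‖ ^ 2 * b))) *
            (W * ‖ξ‖ ^ (2 * s) * ‖φ ξ‖) := fun b hb => by
          have : 0 < b := hb
          simp only [hQ]
          rw [norm_mul, norm_mul, norm_mul, hexp, one_mul, Complex.norm_real, Complex.norm_real,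
            Real.norm_of_nonneg (by positivity), Real.norm_of_nonneg (by positivity)]
        rw [setIntegral_congr_fun measurableSet_Ioi h1, integral_mul_const, hG ξ hξ]
        linear_combination (-Real.Gamma s * W * ‖φ ξ‖) * hcancel ξ hξ
    · have hm1 : Measurable fun p : ℝ × E =>
          ((p.1 ^ (s - 1) * Real.exp (-(‖p.2‖ ^ 2 * p.1)) : ℝ) : ℂ) := by fun_prop
      have hm2 : Measurable fun p : ℝ × E => ((W * ‖p.2‖ ^ (2 * s) : ℝ) : ℂ) := by fun_prop
      have hm3 : Measurable fun p : ℝ × E =>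
        Complex.exp (2 * Real.pi * Complex.I * inner ℝ x p.2) := by fun_prop
      exact hm1.aestronglyMeasurable.mul (hm2.aestronglyMeasurable.mul
        (hm3.aestronglyMeasurable.mul hφi.1.comp_snd))
  have hkey : ∀ b ∈ Ioi (0 : ℝ), ∫ y, ((P b y * fracLap s ψ y : ℝ) : ℂ) = ∫ ξ, Q b ξ :=
    fun b hb => by
      have h1 := integral_gaussian_mul_fracLap hs0 hs1 hψ hc x hb
      rw [← hφ] at h1
      calc _ = ((b ^ (s - 1) : ℝ) : ℂ) * ∫ y, (((Real.pi / b) ^ (d / 2) *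
            Real.exp (-Real.pi ^ 2 * ‖x - y‖ ^ 2 / b) * fracLap s ψ y : ℝ) : ℂ) := by
            rw [← integral_const_mul]
            congr 1 with y
            simp only [hP]
            push_cast; ring
        _ = _ := by
            rw [h1, ← integral_const_mul]
            refine integral_congr_ae ?_
            filter_upwards [hae 0] with ξ hξ
            simp only [hQ]
            rw [Complex.exp_add, hsym ξ hξ]
            push_cast
            ring_nf
  have hfinal : ((A * ∫ y, ‖x - y‖ ^ (2 * s - d) * fracLap s ψ y : ℝ) : ℂ) =
      ((Real.Gamma s * W * ψ x : ℝ) : ℂ) := by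
    calc ((A * ∫ y, ‖x - y‖ ^ (2 * s - d) * fracLap s ψ y : ℝ) : ℂ)
        = ∫ y, ∫ b in Ioi (0 : ℝ), ((P b y * fracLap s ψ y : ℝ) : ℂ) := by
          rw [← integral_const_mul, ← integral_complex_ofReal]
          refine integral_congr_ae ?_
          filter_upwards [hae x] with y hy
          rw [integral_complex_ofReal, integral_mul_const, hPint y hy]
          congr 1; ring
      _ = ∫ b in Ioi (0 : ℝ), ∫ y, ((P b y * fracLap s ψ y : ℝ) : ℂ) :=
          (integral_integral_swap hF1).symm
      _ = ∫ b in Ioi (0 : ℝ), ∫ ξ, Q b ξ := setIntegral_congr_fun measurableSet_Ioi hkey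
      _ = ∫ ξ, ∫ b in Ioi (0 : ℝ), Q b ξ := integral_integral_swap hF2
      _ = ∫ ξ, ((Real.Gamma s * W : ℝ) : ℂ) *
          (Complex.exp (2 * Real.pi * Complex.I * inner ℝ x ξ) * φ ξ) := by
          refine integral_congr_ae ?_
          filter_upwards [hae 0] with ξ hξ
          simp only [hQ]
          rw [integral_mul_const, integral_complex_ofReal, hG ξ hξ, ← mul_assoc,
            ← Complex.ofReal_mul]
          congr 2
          linear_combination (Real.Gamma s * W) * hcancel ξ hξ
      _ = _ := by
          rw [integral_const_mul, (integral_exp_mul_fourier hψ hc x).2]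
          push_cast; ring
  have h := Complex.ofReal_injective hfinal
  rw [div_mul_eq_mul_div, eq_div_iff hA0.ne', ← h, mul_comm]
end

/-! ### Analyticity of integrals of powers of the distance -/

lemma radius_binomialSeries {𝔸 : Type*} [NormedRing 𝔸] [NormedAlgebra ℝ 𝔸] [NormOneClass 𝔸]
    (a : ℝ) : (binomialSeries 𝔸 a).radius = (binomialSeries ℝ a).radius := by
  simp only [FormalMultilinearSeries.radius, binomialSeries,
    FormalMultilinearSeries.ofScalars_norm]

lemma mem_eball_zero_one {G : Type*} [SeminormedAddCommGroup G] {x : G} (hx : ‖x‖ < 1) :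
    x ∈ Metric.eball (0 : G) 1 := by
  rw [← ENNReal.ofReal_one, Metric.eball_ofReal]
  simpa using hx

-- The binomial series is summed in the Banach algebra of bounded continuous functions, and
-- evaluation at a point identifies the sum. Analyticity in the sup norm replaces estimates on
-- derivatives of the kernel that are uniform in `z`.
open scoped BoundedContinuousFunction in
lemma exists_analyticAt_one_add_rpow {X : Type*} [TopologicalSpace X] [Nonempty X] (a : ℝ) :
    ∃ F : (X →ᵇ ℝ) → (X →ᵇ ℝ), AnalyticAt ℝ F 0 ∧
      ∀ ε : X →ᵇ ℝ, ‖ε‖ < 1 → ∀ z, F ε z = (1 + ε z) ^ a := by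
  have hR : 1 ≤ (binomialSeries (X →ᵇ ℝ) a).radius := by
    rw [radius_binomialSeries]; exact binomialSeries_radius_ge_one
  have hF := (binomialSeries (X →ᵇ ℝ) a).hasFPowerSeriesOnBall (one_pos.trans_le hR)
  refine ⟨(binomialSeries (X →ᵇ ℝ) a).sum, hF.analyticAt, fun ε hε z => ?_⟩
  have h1 := hF.hasSum (Metric.eball_subset_eball hR (mem_eball_zero_one hε))
  have h2 := h1.mapL (BoundedContinuousFunction.evalCLM ℝ z)
  have hz : ‖ε z‖ < 1 := (ε.norm_coe_le_norm z).trans_lt hε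
  have h3 := Real.one_add_rpow_hasFPowerSeriesOnBall_zero (a := a).hasSum (mem_eball_zero_one hz)
  simp only [zero_add] at h2 h3
  refine h2.unique ?_
  convert! h3 using 2 with n
  simp only [binomialSeries_apply]
  simp

section
variable {E : Type*} [NormedAddCommGroup E] [InnerProductSpace ℝ E]

/-- Replacing `‖z - x₀‖` by its maximum with `ρ` gives a bounded continuous function on the whole
space, unchanged at distance at least `ρ` from `x₀`, where the density will live. -/
lemma norm_inner_div_max_sq_le (x₀ h z : E) {ρ : ℝ} (hρ : 0 < ρ) :
    ‖inner ℝ h (z - x₀) / max ‖z - x₀‖ ρ ^ 2‖ ≤ ρ⁻¹ * ‖h‖ := by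
  have hm : 0 < max ‖z - x₀‖ ρ := hρ.trans_le (le_max_right _ _)
  rw [Real.norm_eq_abs, abs_div, abs_of_pos (pow_pos hm 2), div_le_iff₀ (pow_pos hm 2)]
  calc |inner ℝ h (z - x₀)| ≤ ‖h‖ * ‖z - x₀‖ := abs_real_inner_le_norm _ _
    _ ≤ ‖h‖ * (ρ⁻¹ * max ‖z - x₀‖ ρ * max ‖z - x₀‖ ρ) := by
      gcongr
      have h1 : 1 ≤ ρ⁻¹ * max ‖z - x₀‖ ρ := by
        rw [← div_eq_inv_mul, one_le_div hρ]; exact le_max_right _ _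
      calc ‖z - x₀‖ ≤ 1 * max ‖z - x₀‖ ρ := by rw [one_mul]; exact le_max_left _ _
        _ ≤ _ := by gcongr
    _ = _ := by ring

open scoped BoundedContinuousFunction in
/-- The bounded functions `z ↦ ⟪h, z - x₀⟫ / max ‖z - x₀‖ ρ ^ 2` depending linearly on `h`. -/
noncomputable def cutInnerCLM (x₀ : E) {ρ : ℝ} (hρ : 0 < ρ) : E →L[ℝ] (E →ᵇ ℝ) :=
  LinearMap.mkContinuous
    { toFun := fun h => BoundedContinuousFunction.ofNormedAddCommGroup
        (fun z => inner ℝ h (z - x₀) / max ‖z - x₀‖ ρ ^ 2)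
        (Continuous.div (by fun_prop) (by fun_prop) fun z =>
          pow_ne_zero 2 (hρ.trans_le (le_max_right _ _)).ne')
        (ρ⁻¹ * ‖h‖) (fun z => norm_inner_div_max_sq_le x₀ h z hρ)
      map_add' := fun h h' => by
        ext z; simp [inner_add_left, add_div]
      map_smul' := fun c h => by
        ext z; simp [inner_smul_left, mul_div_assoc] }
    ρ⁻¹ (fun h => BoundedContinuousFunction.norm_ofNormedAddCommGroup_le _ (by positivity)
      fun z => norm_inner_div_max_sq_le x₀ h z hρ)

lemma cutInnerCLM_apply (x₀ : E) {ρ : ℝ} (hρ : 0 < ρ) (h z : E) :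
    cutInnerCLM x₀ hρ h z = inner ℝ h (z - x₀) / max ‖z - x₀‖ ρ ^ 2 := rfl

open scoped BoundedContinuousFunction in
/-- The bounded function `z ↦ (max ‖z - x₀‖ ρ ^ 2)⁻¹`. -/
noncomputable def cutInvSq (x₀ : E) {ρ : ℝ} (hρ : 0 < ρ) : E →ᵇ ℝ :=
  BoundedContinuousFunction.ofNormedAddCommGroup
    (fun z => (max ‖z - x₀‖ ρ ^ 2)⁻¹)
    (Continuous.inv₀ (by fun_prop) fun z => pow_ne_zero 2 (hρ.trans_le (le_max_right _ _)).ne')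
    (ρ ^ 2)⁻¹ (fun z => by
      rw [Real.norm_of_nonneg (by positivity)]
      gcongr
      exact le_max_right _ _)

lemma cutInvSq_apply (x₀ : E) {ρ : ℝ} (hρ : 0 < ρ) (z : E) :
    cutInvSq x₀ hρ z = (max ‖z - x₀‖ ρ ^ 2)⁻¹ := rfl

variable [MeasurableSpace E] [BorelSpace E]

open scoped BoundedContinuousFunction in
/-- The integral of a bounded continuous function against an integrable density. -/
noncomputable def integralMulCLM (μ : Measure E) {q : E → ℝ} (hq : Integrable q μ) :
    (E →ᵇ ℝ) →L[ℝ] ℝ :=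
  LinearMap.mkContinuous
    { toFun := fun f => ∫ z, f z * q z ∂μ
      map_add' := fun f g => by
        have hi : ∀ f : E →ᵇ ℝ, Integrable (fun z => f z * q z) μ := fun f =>
          hq.bdd_mul f.continuous.measurable.aestronglyMeasurable
            (Filter.Eventually.of_forall f.norm_coe_le_norm)
        simp only [BoundedContinuousFunction.coe_add, Pi.add_apply, add_mul]
        exact integral_add (hi f) (hi g)
      map_smul' := fun c f => by
        simp [mul_assoc, integral_const_mul] }
    (∫ z, ‖q z‖ ∂μ) (fun f => by
      rw [mul_comm, ← integral_const_mul]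
      refine norm_integral_le_of_norm_le (hq.norm.const_mul _)
        (Filter.Eventually.of_forall fun z => ?_)
      rw [norm_mul]
      gcongr
      exact f.norm_coe_le_norm z)

/-- Negative powers of the distance, integrated against a density that vanishes on a ball,
are analytic on that ball. -/
lemma analyticAt_integral_norm_sub_rpow {μ : Measure E} {g : E → ℝ} {r p : ℝ}
    (hg : ∀ z, ‖z‖ < r → g z = 0)
    (hint : ∀ x, ‖x‖ < r → Integrable (fun z => ‖x - z‖ ^ (-p) * g z) μ) {x₀ : E} (hx₀ : ‖x₀‖ < r) :
    AnalyticAt ℝ (fun x => ∫ z, ‖x - z‖ ^ (-p) * g z ∂μ) x₀ := by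
  set ρ := r - ‖x₀‖ with hρd
  have hρ : 0 < ρ := sub_pos.2 hx₀
  obtain ⟨F, hF, hFeq⟩ := exists_analyticAt_one_add_rpow (X := E) (-(p / 2))
  -- Where `‖z - x₀‖ ≥ ρ`, the value `1 + G x z` is `‖x - z‖² / ‖z - x₀‖²`; its power `-p/2` is the
  -- ratio of the kernels at `x` and `x₀`. The map `G` is a quadratic polynomial in `x` vanishing at
  -- `x₀`.
  set G : E → BoundedContinuousFunction E ℝ := fun x =>
    ‖x - x₀‖ ^ 2 • cutInvSq x₀ hρ - (2 : ℝ) • cutInnerCLM x₀ hρ (x - x₀) with hG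
  have hsq : AnalyticAt ℝ (fun x => ‖x - x₀‖ ^ 2) x₀ := by
    have h1 : ContDiff ℝ ω (fun x : E => ‖x - x₀‖ ^ 2) :=
      (contDiff_norm_sq ℝ).comp (contDiff_id.sub contDiff_const)
    exact h1.contDiffAt.analyticAt
  have hT : AnalyticAt ℝ (fun x => cutInnerCLM x₀ hρ (x - x₀)) x₀ :=
    ((cutInnerCLM x₀ hρ).analyticAt _).comp (f := fun x => x - x₀)
      (analyticAt_id.sub analyticAt_const)
  have hGan : AnalyticAt ℝ G x₀ :=
    (hsq.smul analyticAt_const).sub 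
      ((analyticAt_const (v := (2 : ℝ))).smul hT)
  have hG0 : G x₀ = 0 := by simp [hG]
  have hFG : AnalyticAt ℝ (fun x => integralMulCLM μ (hint x₀ hx₀) (F (G x))) x₀ :=
    ((integralMulCLM μ (hint x₀ hx₀)).analyticAt _).comp
      ((by rwa [hG0] : AnalyticAt ℝ F (G x₀)).comp hGan)
  refine hFG.congr ?_
  have hnorm : ∀ᶠ x in nhds x₀, ‖G x‖ < 1 := by
    have := hGan.continuousAt.norm
    refine this.eventually_lt_const ?_
    simp [hG0]
  filter_upwards [hnorm] with x hx
  change ∫ z, F (G x) z * (‖x₀ - z‖ ^ (-p) * g z) ∂μ = _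
  congr 1 with z
  rcases lt_or_ge ‖z‖ r with hz | hz
  · simp [hg z hz]
  · have hw : ρ ≤ ‖z - x₀‖ := by
      have := norm_sub_norm_le z x₀
      rw [hρd]; linarith
    have hw0 : 0 < ‖z - x₀‖ := hρ.trans_le hw
    have hGz : 1 + G x z = ‖x - z‖ ^ 2 / ‖z - x₀‖ ^ 2 := by
      have h1 : ‖x - z‖ ^ 2 = ‖x - x₀‖ ^ 2 - 2 * inner ℝ (x - x₀) (z - x₀) + ‖z - x₀‖ ^ 2 := by
        rw [← norm_sub_sq_real]; congr 2; abel
      simp only [hG, BoundedContinuousFunction.coe_sub, BoundedContinuousFunction.coe_smul,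
        Pi.sub_apply, cutInvSq_apply, cutInnerCLM_apply, max_eq_left hw, smul_eq_mul]
      rw [h1]
      field_simp
      ring
    rw [hFeq _ hx, hGz, Real.div_rpow (by positivity) (by positivity), ← Real.rpow_natCast,
      ← Real.rpow_natCast, ← Real.rpow_mul (norm_nonneg _), ← Real.rpow_mul (norm_nonneg _),
      norm_sub_rev x₀ z]
    have h2 : ((2 : ℕ) : ℝ) * -(p / 2) = -p := by push_cast; ring
    rw [h2]
    have := (Real.rpow_pos_of_pos hw0 (-p)).ne'
    field_simp
end

/-! ### Symmetry of the Riesz potential and balayage by the averaged kernel -/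

section
variable {E : Type*} [NormedAddCommGroup E] [InnerProductSpace ℝ E] [FiniteDimensional ℝ E]
  [MeasurableSpace E] [BorelSpace E]

open Module

lemma integrable_inv_one_add_norm_rpow {p : ℝ} (hp : (finrank ℝ E : ℝ) < p) :
    Integrable (fun x : E => (1 + ‖x‖ ^ p)⁻¹) := by
  have hp0 : 0 < p := (Nat.cast_nonneg _).trans_lt hp
  refine ((integrable_one_add_norm (μ := volume) hp).const_mul (2 ^ p)).mono'
    (by fun_prop : Measurable _).aestronglyMeasurable (Filter.Eventually.of_forall fun x => ?_)
  rw [Real.norm_of_nonneg (by positivity), Real.rpow_neg (by positivity), ← div_eq_mul_inv,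
    inv_le_comm₀ (by positivity) (by positivity), inv_div, div_le_iff₀ (by positivity)]
  rcases le_total ‖x‖ 1 with h | h
  · calc (1 + ‖x‖) ^ p ≤ 2 ^ p := by gcongr; linarith
      _ = 1 * 2 ^ p := (one_mul _).symm
      _ ≤ _ := by gcongr; linarith [Real.rpow_nonneg (norm_nonneg x) p]
  · calc (1 + ‖x‖) ^ p ≤ (‖x‖ * 2) ^ p := by gcongr; linarith
      _ = ‖x‖ ^ p * 2 ^ p := Real.mul_rpow (norm_nonneg _) (by norm_num)
      _ ≤ _ := by gcongr; linarith

/-- The Riesz potential of order `p`, without its normalisation constant. -/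
noncomputable def rieszPotential (p : ℝ) (f : E → ℝ) (y : E) : ℝ :=
  ∫ x, ‖y - x‖ ^ (p - finrank ℝ E) * f x

lemma aestronglyMeasurable_rieszPotential (p : ℝ) {f : E → ℝ} (hf : AEStronglyMeasurable f) :
    AEStronglyMeasurable (rieszPotential p f) :=
  AEStronglyMeasurable.integral_prod_right'
    (f := fun q : E × E => ‖q.1 - q.2‖ ^ (p - finrank ℝ E) * f q.2)
    ((by fun_prop : Measurable fun q : E × E =>
      ‖q.1 - q.2‖ ^ (p - finrank ℝ E)).aestronglyMeasurable.mul hf.comp_snd)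

lemma exists_abs_rieszPotential_le [Nontrivial E] {p : ℝ} (hp : 0 < p) (hpd : p ≤ finrank ℝ E)
    {f : E → ℝ} {B : ℝ} (hf : ∀ y, |f y| ≤ B) (hfi : Integrable f) :
    ∃ C, ∀ y, |rieszPotential p f y| ≤ C := by
  obtain ⟨K, hK, h⟩ := exists_lintegral_riesz_mul_le hp hpd hf hfi
  refine ⟨K.toReal, fun y => ?_⟩
  rw [← Real.norm_eq_abs]
  refine (norm_integral_le_lintegral_norm _).trans (ENNReal.toReal_mono hK.ne ?_)
  refine le_trans (le_of_eq (lintegral_congr fun x => ?_)) (h y)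
  rw [norm_mul, Real.norm_of_nonneg (by positivity), ENNReal.ofReal_mul (by positivity),
    ofReal_norm]

/-- The Riesz potential is symmetric. -/
lemma integral_rieszPotential_mul [Nontrivial E] {p : ℝ} (hp : 0 < p) (hpd : p ≤ finrank ℝ E)
    {f g : E → ℝ} {B : ℝ} (hf : Integrable f) (hg : ∀ y, |g y| ≤ B) (hgi : Integrable g) :
    ∫ y, rieszPotential p f y * g y = ∫ x, f x * rieszPotential p g x := by
  obtain ⟨K, hK, h⟩ := exists_lintegral_riesz_mul_le hp hpd hg hgi
  have hint : Integrable (fun q : E × E => f q.1 * (‖q.1 - q.2‖ ^ (p - finrank ℝ E) * g q.2))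
      (volume.prod volume) := by
    have hm : AEStronglyMeasurable (fun q : E × E =>
        f q.1 * (‖q.1 - q.2‖ ^ (p - finrank ℝ E) * g q.2)) (volume.prod volume) :=
      hf.1.comp_fst.mul ((by fun_prop : Measurable fun q : E × E =>
        ‖q.1 - q.2‖ ^ (p - finrank ℝ E)).aestronglyMeasurable.mul hgi.1.comp_snd)
    refine ⟨hm, ?_⟩
    rw [HasFiniteIntegral, lintegral_prod _ hm.enorm]
    have h1 : ∀ x, ∫⁻ y, ‖f x * (‖x - y‖ ^ (p - finrank ℝ E) * g y)‖ₑ ≤ ‖f x‖ₑ * K := fun x => by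
      have h2 : ∀ y, ‖f x * (‖x - y‖ ^ (p - finrank ℝ E) * g y)‖ₑ =
          ‖f x‖ₑ * (ENNReal.ofReal (‖x - y‖ ^ (p - finrank ℝ E)) * ‖g y‖ₑ) := fun y => by
        rw [enorm_mul, enorm_mul, Real.enorm_eq_ofReal
          (by positivity : 0 ≤ ‖x - y‖ ^ (p - finrank ℝ E))]
      simp only [h2]
      rw [lintegral_const_mul' _ _ enorm_ne_top]
      gcongr
      exact h x
    refine (lintegral_mono h1).trans_lt ?_
    rw [lintegral_mul_const' _ _ hK.ne]
    exact ENNReal.mul_lt_top hf.2 hK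
  calc ∫ y, rieszPotential p f y * g y
      = ∫ y, ∫ x, f x * (‖x - y‖ ^ (p - finrank ℝ E) * g y) := by
        congr 1 with y
        rw [rieszPotential, ← integral_mul_const]
        congr 1 with x
        rw [norm_sub_rev]; ring
    _ = ∫ x, ∫ y, f x * (‖x - y‖ ^ (p - finrank ℝ E) * g y) := (integral_integral_swap hint).symm
    _ = _ := by
        congr 1 with x
        rw [integral_const_mul, rieszPotential]

variable {s a b r : ℝ}

/-- The averaged Poisson kernel of the balls with squared radius in `[a, b]`,
up to normalisation. -/
noncomputable def avgPoisson (s a b : ℝ) (x z : E) : ℝ :=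
  ‖x - z‖ ^ (-(finrank ℝ E : ℝ)) * (poissonWeight s a b (‖z‖ ^ 2)).toReal

lemma measurable_avgPoisson (s a b : ℝ) :
    Measurable (fun q : E × E => avgPoisson s a b q.1 q.2) := by
  unfold avgPoisson; fun_prop

lemma avgPoisson_nonneg (s a b : ℝ) (x z : E) : 0 ≤ avgPoisson s a b x z :=
  mul_nonneg (by positivity) ENNReal.toReal_nonneg

lemma exists_avgPoisson_le (hs0 : 0 < s) (hs1 : s < 1) (ha : 0 < a) (hab : a < b) (hr0 : 0 ≤ r)
    (hr : r ^ 2 < a) :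
    ∃ K, 0 ≤ K ∧ ∀ x z : E, ‖x‖ ≤ r → avgPoisson s a b x z ≤
      K * (1 + ‖z‖ ^ ((finrank ℝ E : ℝ) + 2 * s))⁻¹ :=
  exists_norm_rpow_mul_poissonWeight_le hs0 hs1 ha hab hr0 hr

/-- The Riesz potential of the averaged Poisson kernel outside the balls. -/
lemma integral_riesz_mul_avgPoisson [Nontrivial E] {x y : E} (hs0 : 0 < s) (hs1 : s < 1)
    (hab : a ≤ b) (hx : ‖x‖ ^ 2 < a) (hy : b < ‖y‖ ^ 2) :
    ∫ z, ‖y - z‖ ^ (2 * s - finrank ℝ E) * avgPoisson s a b x z =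
      (rieszBallConst E s).toReal * (poissonNorm s a b (‖x‖ ^ 2) *
        ‖y - x‖ ^ (2 * s - finrank ℝ E)) := by
  have hm : Measurable fun z : E => avgPoisson s a b x z := by unfold avgPoisson; fun_prop
  rw [integral_eq_lintegral_of_nonneg_ae
    (Filter.Eventually.of_forall fun z => mul_nonneg (by positivity) (avgPoisson_nonneg _ _ _ _ _))
    (by fun_prop : Measurable _).aestronglyMeasurable]
  have h1 : ∀ z : E, ENNReal.ofReal (‖y - z‖ ^ (2 * s - finrank ℝ E) * avgPoisson s a b x z) =
      poissonWeight s a b (‖z‖ ^ 2) * ENNReal.ofReal (‖x - z‖ ^ (-(finrank ℝ E : ℝ)) *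
      ‖z - y‖ ^ (2 * s - finrank ℝ E)) := fun z => by
    rw [avgPoisson, ← ENNReal.ofReal_toReal (poissonWeight_lt_top a b hs0 hs1 (‖z‖ ^ 2)).ne,
      ← ENNReal.ofReal_mul ENNReal.toReal_nonneg, norm_sub_rev y z,
      ENNReal.toReal_ofReal ENNReal.toReal_nonneg]
    congr 1; ring
  simp only [h1]
  rw [lintegral_poissonWeight_mul_riesz hs1 hab hx hy, ENNReal.toReal_mul,
    ENNReal.toReal_ofReal (mul_nonneg (poissonNorm_nonneg hs1 hab hx) (by positivity)),
    norm_sub_rev, mul_comm]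

/-- The averaged Poisson kernel integrated against a density on the inner ball. -/
noncomputable def sweep (s a b : ℝ) (χ : E → ℝ) (z : E) : ℝ := ∫ x, χ x * avgPoisson s a b x z

variable {χ : E → ℝ}

lemma integrable_prod_sweep {h : E → ℝ} (hs0 : 0 < s) (hs1 : s < 1) (ha : 0 < a) (hab : a < b)
    (hr0 : 0 ≤ r) (hr : r ^ 2 < a) (hχ : Integrable χ) (hχr : ∀ x, r < ‖x‖ → χ x = 0)
    (hh : Integrable (fun z => h z * (1 + ‖z‖ ^ ((finrank ℝ E : ℝ) + 2 * s))⁻¹))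
    (hhm : AEStronglyMeasurable h) :
    Integrable (fun q : E × E => χ q.1 * (h q.2 * avgPoisson s a b q.1 q.2))
      (volume.prod volume) := by
  obtain ⟨K, hK, hKle⟩ := exists_avgPoisson_le (E := E) hs0 hs1 ha hab hr0 hr
  refine ((hχ.norm.mul_prod hh.norm).const_mul K).mono' (hχ.1.comp_fst.mul
    (hhm.comp_snd.mul (measurable_avgPoisson s a b).aestronglyMeasurable))
    (Filter.Eventually.of_forall fun q => ?_)
  rcases le_or_gt ‖q.1‖ r with h1 | h1
  · rw [norm_mul, norm_mul, norm_mul, Real.norm_of_nonneg (avgPoisson_nonneg _ _ _ _ _),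
      Real.norm_of_nonneg (by positivity : 0 ≤ (1 + ‖q.2‖ ^ ((finrank ℝ E : ℝ) + 2 * s))⁻¹)]
    calc _ ≤ ‖χ q.1‖ * (‖h q.2‖ * (K * (1 + ‖q.2‖ ^ ((finrank ℝ E : ℝ) + 2 * s))⁻¹)) := by
          gcongr; exact hKle _ _ h1
      _ = _ := by ring
  · simp [hχr _ h1]

/-- Sweeping a density is dual to integrating against the averaged kernel. This is used with `h` a
Riesz kernel, to compute potentials, and with `h = u`, to produce its Poisson integral. -/
lemma integral_mul_sweep {h : E → ℝ} (hs0 : 0 < s) (hs1 : s < 1) (ha : 0 < a) (hab : a < b)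
    (hr0 : 0 ≤ r) (hr : r ^ 2 < a) (hχ : Integrable χ) (hχr : ∀ x, r < ‖x‖ → χ x = 0)
    (hh : Integrable (fun z => h z * (1 + ‖z‖ ^ ((finrank ℝ E : ℝ) + 2 * s))⁻¹))
    (hhm : AEStronglyMeasurable h) :
    Integrable (fun z => h z * sweep s a b χ z) ∧
    Integrable (fun x => χ x * ∫ z, h z * avgPoisson s a b x z) ∧
    ∫ z, h z * sweep s a b χ z = ∫ x, χ x * ∫ z, h z * avgPoisson s a b x z := by
  have hi := integrable_prod_sweep hs0 hs1 ha hab hr0 hr hχ hχr hh hhm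
  have h1 : ∀ z, h z * sweep s a b χ z = ∫ x, χ x * (h z * avgPoisson s a b x z) := fun z => by
    rw [sweep, ← integral_const_mul]
    congr 1 with x
    ring
  have h2 : ∀ x, χ x * ∫ z, h z * avgPoisson s a b x z =
      ∫ z, χ x * (h z * avgPoisson s a b x z) := fun x => (integral_const_mul _ _).symm
  simp only [h1, h2]
  exact ⟨hi.integral_prod_right, hi.integral_prod_left, (integral_integral_swap hi).symm⟩

lemma exists_abs_sweep_le (hs0 : 0 < s) (hs1 : s < 1) (ha : 0 < a) (hab : a < b)
    (hr0 : 0 ≤ r) (hr : r ^ 2 < a) (hχ : Integrable χ) (hχr : ∀ x, r < ‖x‖ → χ x = 0) :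
    ∃ C, 0 ≤ C ∧ ∀ z, |sweep s a b χ z| ≤ C * (1 + ‖z‖ ^ ((finrank ℝ E : ℝ) + 2 * s))⁻¹ := by
  obtain ⟨K, hK, hKle⟩ := exists_avgPoisson_le (E := E) hs0 hs1 ha hab hr0 hr
  have hI : 0 ≤ ∫ x, ‖χ x‖ := integral_nonneg fun _ => norm_nonneg _
  refine ⟨(∫ x, ‖χ x‖) * K, by positivity, fun z => ?_⟩
  rw [← Real.norm_eq_abs, mul_assoc, ← integral_mul_const]
  refine norm_integral_le_of_norm_le (hχ.norm.mul_const _)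
    (Filter.Eventually.of_forall fun x => ?_)
  rcases le_or_gt ‖x‖ r with h1 | h1
  · rw [norm_mul, Real.norm_of_nonneg (avgPoisson_nonneg _ _ _ _ _)]
    gcongr
    exact hKle _ _ h1
  · rw [hχr _ h1, zero_mul, norm_zero, zero_mul]

lemma aestronglyMeasurable_sweep (hχ : AEStronglyMeasurable χ) :
    AEStronglyMeasurable (sweep s a b χ) :=
  AEStronglyMeasurable.integral_prod_right'
    (f := fun q : E × E => χ q.2 * avgPoisson s a b q.2 q.1)
    (hχ.comp_snd.mul ((measurable_avgPoisson s a b).comp measurable_swap).aestronglyMeasurable)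

/-- The Riesz potentials of a density and of its balayage agree outside the balls. -/
lemma rieszPotential_sweep [Nontrivial E] (hs0 : 0 < s) (hs1 : s < 1) (hsd : 2 * s ≤ finrank ℝ E)
    (ha : 0 < a) (hab : a < b)
    (hr0 : 0 ≤ r) (hr : r ^ 2 < a) (hχ : Integrable χ) (hχr : ∀ x, r < ‖x‖ → χ x = 0) {y : E}
    (hy : b < ‖y‖ ^ 2) :
    rieszPotential (2 * s) (sweep s a b χ) y = (rieszBallConst E s).toReal *
      rieszPotential (2 * s) (fun x => poissonNorm s a b (‖x‖ ^ 2) * χ x) y := by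
  have hw := integrable_inv_one_add_norm_rpow (E := E)
    (show (finrank ℝ E : ℝ) < finrank ℝ E + 2 * s by linarith)
  have hw1 : ∀ z : E, |(1 + ‖z‖ ^ ((finrank ℝ E : ℝ) + 2 * s))⁻¹| ≤ 1 := fun z => by
    rw [abs_of_nonneg (by positivity)]
    exact inv_le_one_of_one_le₀ (by
      linarith [Real.rpow_nonneg (norm_nonneg z) ((finrank ℝ E : ℝ) + 2 * s)])
  have h := (integral_mul_sweep (h := fun z => ‖y - z‖ ^ (2 * s - finrank ℝ E)) hs0 hs1 ha hab
    hr0 hr hχ hχr (integrable_riesz_mul (by linarith) hsd hw1 hw y)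
    (by fun_prop : Measurable _).aestronglyMeasurable).2.2
  rw [rieszPotential, h, rieszPotential, ← integral_const_mul]
  congr 1 with x
  -- The potential of the kernel is known only for `‖x‖² < a`; beyond radius `r` the density
  -- vanishes.
  rcases le_or_gt ‖x‖ r with h1 | h1
  · have hx : ‖x‖ ^ 2 < a := lt_of_le_of_lt (by gcongr) hr
    rw [integral_riesz_mul_avgPoisson hs0 hs1 hab.le hx hy]
    ring
  · rw [hχr _ h1]; ring
end

/-! ### Orthogonality, the Poisson representation and analyticity -/

lemma analyticAt_poissonNorm_comp {E : Type*} [NormedAddCommGroup E] [InnerProductSpace ℝ E]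
    {s a b : ℝ} (hab : a ≤ b) {x : E} (hx : ‖x‖ ^ 2 < a) :
    AnalyticAt ℝ (fun x : E => poissonNorm s a b (‖x‖ ^ 2)) x := by
  have hn : ContDiffAt ℝ ω (fun x : E => ‖x‖ ^ 2) x := (contDiff_norm_sq ℝ).contDiffAt
  have h : ∀ c : ℝ, a ≤ c → ContDiffAt ℝ ω (fun x : E => (c - ‖x‖ ^ 2) ^ (1 - s)) x := fun c hc =>
    (contDiffAt_const.sub hn).rpow_const_of_ne (by linarith : c - ‖x‖ ^ 2 ≠ 0)
  exact (((h b hab).sub (h a le_rfl)).div_const _).analyticAt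

section
variable {E : Type*} [NormedAddCommGroup E] [InnerProductSpace ℝ E] [FiniteDimensional ℝ E]
  [MeasurableSpace E] [BorelSpace E]

open Module

variable {s a b r : ℝ} {u χ : E → ℝ}

/-- The density `u` integrates to zero against every function with bounded weighted norm that is the
fractional Laplacian, in the sense of distributions, of a function compactly supported in the unit
ball. -/
def IsFracLapHarmonic (s : ℝ) (u : E → ℝ) : Prop :=
  ∀ φ f : E → ℝ, Integrable φ → HasCompactSupport φ → tsupport φ ⊆ Metric.ball 0 1 →
    (∀ ψ : E → ℝ, ContDiff ℝ ∞ ψ → HasCompactSupport ψ →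
      ∫ x, φ x * fracLap s ψ x = ∫ x, f x * ψ x) →
    AEStronglyMeasurable f →
    (∃ C : ℝ, ∀ x, (1 + ‖x‖ ^ ((finrank ℝ E : ℝ) + 2 * s)) * |f x| ≤ C) →
    ∫ x, u x * f x = 0

/-- The fractional Laplacian of a Riesz potential in the sense of distributions. -/
lemma exists_integral_rieszPotential_mul_fracLap [Nontrivial E] (hs0 : 0 < s) (hs1 : s < 1)
    (hsd : 2 * s < finrank ℝ E) :
    ∃ c : ℝ, 0 < c ∧ ∀ f : E → ℝ, Integrable f → ∀ ψ : E → ℝ, ContDiff ℝ ∞ ψ →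
      HasCompactSupport ψ →
      ∫ y, rieszPotential (2 * s) f y * fracLap s ψ y = c * ∫ x, f x * ψ x := by
  obtain ⟨c, hc, h⟩ := exists_integral_riesz_mul_fracLap (E := E) hs0 hs1 hsd
  refine ⟨c, hc, fun f hf ψ hψ hψc => ?_⟩
  obtain ⟨B, hB⟩ := exists_abs_fracLap_le hs0 hs1 hψ hψc
  rw [integral_rieszPotential_mul (by linarith) hsd.le hf hB (integrable_fracLap hs0 hs1 hψ hψc),
    ← integral_const_mul]
  congr 1 with x
  rw [rieszPotential, h ψ hψ hψc x]
  ring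

/-- A density whose Riesz potential vanishes outside a compact subset of the unit ball is
orthogonal to harmonic functions. -/
lemma IsFracLapHarmonic.integral_mul_eq_zero [Nontrivial E] (hu : IsFracLapHarmonic s u)
    (hs0 : 0 < s) (hs1 : s < 1) (hsd : 2 * s < finrank ℝ E) (hb1 : b < 1) {f : E → ℝ} {C : ℝ}
    (hf : AEStronglyMeasurable f)
    (hfC : ∀ x, |f x| ≤ C * (1 + ‖x‖ ^ ((finrank ℝ E : ℝ) + 2 * s))⁻¹)
    (hz : ∀ y, b < ‖y‖ ^ 2 → rieszPotential (2 * s) f y = 0) :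
    ∫ x, u x * f x = 0 := by
  obtain ⟨c, hc, hcf⟩ := exists_integral_rieszPotential_mul_fracLap (E := E) hs0 hs1 hsd
  have hw1 : ∀ x : E, 1 ≤ 1 + ‖x‖ ^ ((finrank ℝ E : ℝ) + 2 * s) := fun x => by
    linarith [Real.rpow_nonneg (norm_nonneg x) ((finrank ℝ E : ℝ) + 2 * s)]
  have hC0 : 0 ≤ C := by
    have := (abs_nonneg _).trans (hfC 0)
    exact nonneg_of_mul_nonneg_left this (inv_pos.2 (one_pos.trans_le (hw1 0)))
  have hfi : Integrable f :=
    ((integrable_inv_one_add_norm_rpow (by linarith)).const_mul C).mono' hf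
      (Filter.Eventually.of_forall hfC)
  have hfb : ∀ x, |f x| ≤ C := fun x =>
    (hfC x).trans (mul_le_of_le_one_right hC0 (inv_le_one_of_one_le₀ (hw1 x)))
  obtain ⟨B, hB⟩ := exists_abs_rieszPotential_le (by linarith : 0 < 2 * s) hsd.le hfb hfi
  -- The test function is the Riesz potential of `f`, scaled so that its fractional Laplacian is
  -- `f`. It vanishes outside the closed ball of radius `√b < 1`, hence is admissible.
  set φ : E → ℝ := fun y => c⁻¹ * rieszPotential (2 * s) f y with hφ
  have hφ0 : ∀ y ∉ Metric.closedBall (0 : E) √b, φ y = 0 := fun y hy => by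
    have h1 : √b < ‖y‖ := by simpa using hy
    rw [hφ]
    simp only
    rw [hz y ((Real.sqrt_lt' ((Real.sqrt_nonneg b).trans_lt h1)).1 h1), mul_zero]
  have hsupp : Function.support φ ⊆ Metric.closedBall (0 : E) √b := fun y hy =>
    by_contra fun h => hy (hφ0 y h)
  refine hu φ f ?_ (HasCompactSupport.intro (isCompact_closedBall 0 √b) hφ0) ?_ ?_ hf ⟨C, ?_⟩
  · rw [← integrableOn_iff_integrable_of_support_subset hsupp]
    refine Integrable.const_mul ?_ _
    exact Measure.integrableOn_of_bounded measure_closedBall_lt_top.ne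
      (aestronglyMeasurable_rieszPotential _ hf) (M := B) (Filter.Eventually.of_forall hB)
  · refine (closure_minimal hsupp
      Metric.isClosed_closedBall).trans (Metric.closedBall_subset_ball ?_)
    rw [Real.sqrt_lt' one_pos]; simpa using hb1
  · intro ψ hψ hψc
    simp only [hφ, mul_assoc]
    rw [integral_const_mul, hcf f hfi ψ hψ hψc, inv_mul_cancel_left₀ hc.ne']
  · intro x
    have h1 := hfC x
    have h2 := one_pos.trans_le (hw1 x)
    rwa [← div_eq_mul_inv, le_div_iff₀ h2, mul_comm] at h1

/-- The averaged Poisson integral of `u`. -/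
noncomputable def avgPoissonIntegral (s a b : ℝ) (u : E → ℝ) (x : E) : ℝ :=
  ∫ z, u z * avgPoisson s a b x z

lemma integrable_mul_avgPoisson (hs0 : 0 < s) (hs1 : s < 1) (ha : 0 < a) (hab : a < b)
    (hum : AEStronglyMeasurable u)
    (hu : Integrable (fun z => u z * (1 + ‖z‖ ^ ((finrank ℝ E : ℝ) + 2 * s))⁻¹)) {x : E}
    (hx : ‖x‖ ^ 2 < a) : Integrable (fun z => u z * avgPoisson s a b x z) := by
  obtain ⟨K, hK, hKle⟩ := exists_avgPoisson_le (E := E) hs0 hs1 ha hab (norm_nonneg x) hx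
  refine (hu.norm.const_mul K).mono' (hum.mul
    ((measurable_avgPoisson s a b).comp measurable_prodMk_left).aestronglyMeasurable)
    (Filter.Eventually.of_forall fun z => ?_)
  rw [norm_mul, norm_mul, Real.norm_of_nonneg (avgPoisson_nonneg _ _ _ _ _),
    Real.norm_of_nonneg (by positivity : 0 ≤ (1 + ‖z‖ ^ ((finrank ℝ E : ℝ) + 2 * s))⁻¹)]
  calc _ ≤ ‖u z‖ * (K * (1 + ‖z‖ ^ ((finrank ℝ E : ℝ) + 2 * s))⁻¹) := by
        gcongr; exact hKle _ _ le_rfl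
    _ = _ := by ring

lemma analyticAt_avgPoissonIntegral (hs0 : 0 < s) (hs1 : s < 1) (ha : 0 < a) (hab : a < b)
    (hum : AEStronglyMeasurable u)
    (hu : Integrable (fun z => u z * (1 + ‖z‖ ^ ((finrank ℝ E : ℝ) + 2 * s))⁻¹)) {x : E}
    (hx : ‖x‖ ^ 2 < a) : AnalyticAt ℝ (avgPoissonIntegral s a b u) x := by
  have hlt : ∀ z : E, ‖z‖ < √a ↔ ‖z‖ ^ 2 < a := fun z => Real.lt_sqrt (norm_nonneg z)
  have heq : ∀ x z : E, u z * avgPoisson s a b x z = ‖x - z‖ ^ (-(finrank ℝ E : ℝ)) *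
      ((poissonWeight s a b (‖z‖ ^ 2)).toReal * u z) := fun x z => by
    rw [avgPoisson]; ring
  have h := analyticAt_integral_norm_sub_rpow (μ := (volume : Measure E)) (r := √a)
    (p := finrank ℝ E) (g := fun z => (poissonWeight s a b (‖z‖ ^ 2)).toReal * u z) (x₀ := x)
    (fun z hz => by simp [poissonWeight_eq_zero ((hlt z).1 hz).le])
    (fun x hx => by
      simp only [← heq]
      exact integrable_mul_avgPoisson hs0 hs1 ha hab hum hu ((hlt x).1 hx)) ((hlt x).2 hx)
  simp only [← heq] at h
  exact h

/-- The averaged Poisson representation of harmonic functions. -/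
theorem IsFracLapHarmonic.avgPoissonIntegral_eq [Nontrivial E] (hu : IsFracLapHarmonic s u)
    (hs0 : 0 < s) (hs1 : s < 1) (hsd : 2 * s < finrank ℝ E) (ha : 0 < a) (hab : a < b)
    (hb1 : b < 1) (hum : AEStronglyMeasurable u)
    (hui : Integrable (fun z => u z * (1 + ‖z‖ ^ ((finrank ℝ E : ℝ) + 2 * s))⁻¹))
    (huc : ContinuousOn u (Metric.ball 0 1)) {x : E} (hx : ‖x‖ ^ 2 < a) :
    (rieszBallConst E s).toReal * (poissonNorm s a b (‖x‖ ^ 2) * u x) =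
      avgPoissonIntegral s a b u x := by
  set C' := (rieszBallConst E s).toReal with hC'
  have hC'0 : 0 ≤ C' := ENNReal.toReal_nonneg
  obtain ⟨r, hxr, hra⟩ := exists_between (Real.lt_sqrt_of_sq_lt hx)
  have hr0 : 0 ≤ r := (norm_nonneg x).trans hxr.le
  have hr : r ^ 2 < a := (Real.lt_sqrt hr0).1 hra
  have hball : ∀ z ∈ Metric.closedBall (0 : E) r, ‖z‖ ^ 2 < a := fun z hz =>
    lt_of_le_of_lt (by gcongr; simpa using hz) hr
  have hcD : ContinuousOn (fun x : E => poissonNorm s a b (‖x‖ ^ 2)) (Metric.closedBall 0 r) :=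
    fun z hz => (analyticAt_poissonNorm_comp hab.le (hball z hz)).continuousAt.continuousWithinAt
  have hr1 : r < 1 := by nlinarith
  have hcu : ContinuousOn u (Metric.closedBall 0 r) :=
    huc.mono (Metric.closedBall_subset_ball hr1)
  have hcA : ContinuousOn (avgPoissonIntegral s a b u) (Metric.closedBall 0 r) := fun z hz =>
    (analyticAt_avgPoissonIntegral hs0 hs1 ha hab hum hui
      (hball z hz)).continuousAt.continuousWithinAt
  -- The defect in the representation formula; the aim is `v = 0`.
  set v : E → ℝ := fun x => C' * (poissonNorm s a b (‖x‖ ^ 2) * u x) -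
    avgPoissonIntegral s a b u x with hv
  have hcv : ContinuousOn v (Metric.closedBall 0 r) :=
    (continuousOn_const.mul (hcD.mul hcu)).sub hcA
  have hK : IsCompact (Metric.closedBall (0 : E) r) := isCompact_closedBall 0 r
  have hKm : MeasurableSet (Metric.closedBall (0 : E) r) := measurableSet_closedBall
  -- The density to be swept is the defect itself, so that the duality pairing becomes the integral
  -- of `v²`.
  set χ : E → ℝ := (Metric.closedBall (0 : E) r).indicator v with hχ
  have hχr : ∀ x, r < ‖x‖ → χ x = 0 := fun z hz => indicator_of_notMem (by simpa using hz) _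
  have hχi : Integrable χ := (integrable_indicator_iff hKm).2 (hcv.integrableOn_compact hK)
  set g : E → ℝ := (Metric.closedBall (0 : E) r).indicator
    (fun x => C' * (poissonNorm s a b (‖x‖ ^ 2) * v x)) with hg
  have hgχ : ∀ x, g x = C' * (poissonNorm s a b (‖x‖ ^ 2) * χ x) := fun z => by
    by_cases h : z ∈ Metric.closedBall (0 : E) r
    · rw [hg, hχ, indicator_of_mem h, indicator_of_mem h]
    · rw [hg, hχ, indicator_of_notMem h, indicator_of_notMem h, mul_zero, mul_zero]
  have hcg : ContinuousOn (fun x => C' * (poissonNorm s a b (‖x‖ ^ 2) * v x))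
      (Metric.closedBall (0 : E) r) := continuousOn_const.mul (hcD.mul hcv)
  have hgi : Integrable g := (integrable_indicator_iff hKm).2 (hcg.integrableOn_compact hK)
  obtain ⟨G, hG⟩ := hK.exists_bound_of_continuousOn hcg
  have hG0 : 0 ≤ G := (norm_nonneg _).trans (hG 0 (by simpa using hr0))
  obtain ⟨S, hS0, hS⟩ := exists_abs_sweep_le hs0 hs1 ha hab hr0 hr hχi hχr
  set p : ℝ := (finrank ℝ E : ℝ) + 2 * s with hp
  have hp0 : 0 ≤ p := by positivity
  have hgb : ∀ x, |g x| ≤ G * (1 + r ^ p) * (1 + ‖x‖ ^ p)⁻¹ := fun z => by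
    by_cases h : z ∈ Metric.closedBall (0 : E) r
    · have h1 := hG z h
      have h2 : ‖z‖ ^ p ≤ r ^ p := by
        gcongr
        simpa using h
      rw [hg, indicator_of_mem h, ← div_eq_mul_inv, le_div_iff₀ (by positivity)]
      rw [Real.norm_eq_abs] at h1
      gcongr
    · rw [hg, indicator_of_notMem h, abs_zero]; positivity
  have hw := integrable_inv_one_add_norm_rpow (E := E) (show (finrank ℝ E : ℝ) < p by linarith)
  have hsm : AEStronglyMeasurable (sweep s a b χ) := aestronglyMeasurable_sweep hχi.1
  have hsi : Integrable (sweep s a b χ) :=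
    (hw.const_mul S).mono' hsm (Filter.Eventually.of_forall hS)
  have hsb : ∀ z, |sweep s a b χ z| ≤ S := fun z => (hS z).trans (mul_le_of_le_one_right hS0
    (inv_le_one_of_one_le₀ (by linarith [Real.rpow_nonneg (norm_nonneg z) p])))
  have hgb' : ∀ z, |g z| ≤ G * (1 + r ^ p) := fun z => (hgb z).trans (mul_le_of_le_one_right
    (by positivity)
    (inv_le_one_of_one_le₀ (by linarith [Real.rpow_nonneg (norm_nonneg z) p])))
  -- Outside the balls the potentials of `g` and of the sweep of `χ` coincide, and both are bounded
  -- with the decay of `L^∞_s`; so `u` is orthogonal to the difference.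
  have hzero : ∫ x, u x * (g x - sweep s a b χ x) = 0 := by
    refine hu.integral_mul_eq_zero hs0 hs1 hsd hb1 (C := G * (1 + r ^ p) + S) (hgi.1.sub hsm)
      (fun z => ?_) fun y hy => ?_
    · rw [add_mul]
      exact (abs_sub _ _).trans (add_le_add (hgb z) (hS z))
    · have h1 := rieszPotential_sweep hs0 hs1 hsd.le ha hab hr0 hr hχi hχr hy
      have h2 : rieszPotential (2 * s) g y = C' *
          rieszPotential (2 * s) (fun x => poissonNorm s a b (‖x‖ ^ 2) * χ x) y := by
        rw [rieszPotential, rieszPotential, ← integral_const_mul]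
        congr 1 with x
        rw [hgχ]; ring
      have h3 : rieszPotential (2 * s) (fun x => g x - sweep s a b χ x) y =
          rieszPotential (2 * s) g y - rieszPotential (2 * s) (sweep s a b χ) y := by
        rw [rieszPotential, rieszPotential, rieszPotential, ← integral_sub
          (integrable_riesz_mul (by linarith) hsd.le hgb' hgi y)
          (integrable_riesz_mul (by linarith) hsd.le hsb hsi y)]
        congr 1 with x
        ring
      rw [h3, h1, h2, sub_self]
  obtain ⟨hi1, hi2, heq⟩ := integral_mul_sweep hs0 hs1 ha hab hr0 hr hχi hχr hui hum
  have hug : Integrable (fun x => u x * g x) := by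
    have : (fun x => u x * g x) = (Metric.closedBall (0 : E) r).indicator
        (fun x => u x * (C' * (poissonNorm s a b (‖x‖ ^ 2) * v x))) := by
      ext z
      by_cases h : z ∈ Metric.closedBall (0 : E) r
      · rw [hg, indicator_of_mem h, indicator_of_mem h]
      · rw [hg, indicator_of_notMem h, indicator_of_notMem h, mul_zero]
    rw [this, integrable_indicator_iff hKm]
    exact (hcu.mul hcg).integrableOn_compact hK
  have hsq : ∫ x in Metric.closedBall (0 : E) r, v x ^ 2 = 0 := by
    rw [← integral_indicator hKm]
    simp only [mul_sub] at hzero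
    rw [integral_sub hug hi1, heq, ← integral_sub hug hi2] at hzero
    rw [← hzero]
    congr 1 with z
    rw [hgχ, hχ]
    by_cases h : z ∈ Metric.closedBall (0 : E) r
    · rw [indicator_of_mem h, indicator_of_mem h]
      simp only [hv, avgPoissonIntegral]
      ring
    · rw [indicator_of_notMem h, indicator_of_notMem h]
      ring
  -- Vanishing almost everywhere is upgraded on the open ball, which contains `x` and on which `v`
  -- is continuous.
  have hae : v =ᵐ[volume.restrict (Metric.ball (0 : E) r)] 0 := by
    have h1 := (integral_eq_zero_iff_of_nonneg (fun x => sq_nonneg (v x))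
      ((hcv.pow 2).integrableOn_compact hK)).1 hsq
    refine ae_restrict_of_ae_restrict_of_subset Metric.ball_subset_closedBall ?_
    filter_upwards [h1] with z hz
    exact pow_eq_zero_iff two_ne_zero |>.1 hz
  have hvx := Measure.eqOn_open_of_ae_eq hae Metric.isOpen_ball
    (hcv.mono Metric.ball_subset_closedBall) continuousOn_const
    (show x ∈ Metric.ball (0 : E) r by simpa using hxr)
  exact sub_eq_zero.1 hvx

/-- Choose `‖x‖² < a < b < 1`. Near `x` the representation exhibits `u` as a quotient of analytic
functions with nonzero denominator. -/
theorem IsFracLapHarmonic.analyticOnNhd [Nontrivial E] (hu : IsFracLapHarmonic s u)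
    (hs0 : 0 < s) (hs1 : s < 1) (hsd : 2 * s < finrank ℝ E) (hum : AEStronglyMeasurable u)
    (hui : Integrable (fun z => u z * (1 + ‖z‖ ^ ((finrank ℝ E : ℝ) + 2 * s))⁻¹))
    (huc : ContinuousOn u (Metric.ball 0 1)) : AnalyticOnNhd ℝ u (Metric.ball 0 1) := by
  intro x hx
  have hx1 : ‖x‖ ^ 2 < 1 := pow_lt_one₀ (norm_nonneg _) (by simpa using hx) two_ne_zero
  obtain ⟨a, hxa, ha1⟩ := exists_between hx1
  obtain ⟨b, hab, hb1⟩ := exists_between ha1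
  have ha : 0 < a := (sq_nonneg _).trans_lt hxa
  have hC : 0 < (rieszBallConst E s).toReal :=
    ENNReal.toReal_pos (rieszBallConst_ne_zero s) (rieszBallConst_ne_top hs0 hs1)
  have hD := analyticAt_poissonNorm_comp (s := s) hab.le hxa
  have hA := analyticAt_avgPoissonIntegral hs0 hs1 ha hab hum hui hxa
  have hD0 := (poissonNorm_pos hs1 hab hxa).ne'
  refine (hA.div (analyticAt_const.mul hD) (mul_ne_zero hC.ne' hD0)).congr ?_
  have hnhds : ∀ᶠ y in nhds x, ‖y‖ ^ 2 < a :=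
    (by fun_prop : Continuous fun y : E => ‖y‖ ^ 2).continuousAt.eventually_lt_const hxa
  filter_upwards [hnhds] with y hy
  have h := hu.avgPoissonIntegral_eq hs0 hs1 hsd ha hab hb1 hum hui huc hy
  have hDy := (poissonNorm_pos hs1 hab hy).ne'
  simp only [Pi.div_apply, Pi.mul_apply]
  rw [← h]
  field_simp
end

/-! ### Return to the normalised fractional Laplacian -/

lemma fracLaplacianConst_pos {N : ℕ} {s : ℝ} (hs0 : 0 < s) (hs1 : s < 1) :
    0 < fracLaplacianConst N s := by
  have h1 := Real.Gamma_pos_of_pos (show 0 < (N : ℝ) / 2 + s by positivity)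
  have h2 := Real.Gamma_pos_of_pos (show 0 < 1 - s by linarith)
  have := Real.pi_pos
  unfold fracLaplacianConst
  positivity

lemma fracLaplacian_eq {N : ℕ} (s : ℝ) (ψ : EuclideanSpace ℝ (Fin N) → ℝ)
    (x : EuclideanSpace ℝ (Fin N)) :
    fracLaplacian s ψ x = fracLaplacianConst N s / 2 * fracLap s ψ x := by
  simp [fracLaplacian, fracLap, secondDiff]

/-- The nonzero factor `C_{N,s} / 2` is absorbed into the test function `φ`, leaving `f` unchanged.
-/
lemma IsVeryWeakSHarmonicOn.isFracLapHarmonic {N : ℕ} {s : ℝ} (hs0 : 0 < s) (hs1 : s < 1)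
    {u : EuclideanSpace ℝ (Fin N) → ℝ} (hu : IsVeryWeakSHarmonicOn s u (Metric.ball 0 1)) :
    IsFracLapHarmonic s u := by
  intro φ f hφ hφc hφs hφf hf hfC
  have hc : fracLaplacianConst N s / 2 ≠ 0 := (half_pos (fracLaplacianConst_pos hs0 hs1)).ne'
  obtain ⟨C, hC⟩ := hfC
  simp only [finrank_euclideanSpace_fin] at hC
  have h := hu (fun x => (fracLaplacianConst N s / 2)⁻¹ * φ x) f (hφ.const_mul _)
    (hφc.mul_left) ((closure_mono (Function.support_mul_subset_right _ _)).trans hφs)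
    (fun ψ hψ hψc => by
      rw [← hφf ψ hψ hψc]
      congr 1 with x
      rw [fracLaplacian_eq, mul_mul_mul_comm, inv_mul_cancel₀ hc, one_mul])
    ⟨hf, C, Filter.Eventually.of_forall hC⟩
  exact h

theorem mainTheorem4 (N : ℕ) (hN : 2 ≤ N) (s : ℝ) (hs0 : 0 < s) (hs1 : s < 1)
    (γ : ℝ) (hγ0 : 0 < γ) (hγ1 : γ < 1)
    (u : EuclideanSpace ℝ (Fin N) → ℝ)
    (hu_holder : HolderLocOn (γ + 2 * s) u (Metric.ball 0 1))
    (hu_L1s : MemL1s s u)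
    (hu_harmonic : IsVeryWeakSHarmonicOn s u (Metric.ball 0 1)) :
    AnalyticOnNhd ℝ u (Metric.ball 0 1) := by
  obtain ⟨k, α, -, -, -, hk, -⟩ := hu_holder
  have : Nonempty (Fin N) := ⟨⟨0, by omega⟩⟩
  have hN' : (2 : ℝ) ≤ N := by exact_mod_cast hN
  have hui : Integrable (fun z => u z *
      (1 + ‖z‖ ^ ((Module.finrank ℝ (EuclideanSpace ℝ (Fin N)) : ℝ) + 2 * s))⁻¹) := by
    simpa [MemL1s, div_eq_mul_inv] using hu_L1s
  have hum : AEStronglyMeasurable u := by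
    have hm : Measurable fun z : EuclideanSpace ℝ (Fin N) => 1 + ‖z‖ ^ ((N : ℝ) + 2 * s) := by
      fun_prop
    refine (hu_L1s.1.mul hm.aestronglyMeasurable).congr (Filter.Eventually.of_forall fun z => ?_)
    have : 1 + ‖z‖ ^ ((N : ℝ) + 2 * s) ≠ 0 := by positivity
    simp only [Pi.mul_apply]
    field_simp
  -- The bound `2s < N` needed for the Riesz kernel follows from `s < 1` and `N ≥ 2`.
  exact (hu_harmonic.isFracLapHarmonic hs0 hs1).analyticOnNhd hs0 hs1
    (by rw [finrank_euclideanSpace_fin]; linarith) hum hui hk.continuousOn
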